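/- Let $n\ge 1$, $[n]=\{1,\dots,n\}$, and let $\kappa_1<\dots<\kappa_n$ be real numbers that are generic in the sense that, for each $d$ with $2\le d\le k$, the sums $\sum_{i\in I}\kappa_i$ over the $d$-element subsets $I\subseteq[n]$ are pairwise distinct. \emph{Necklaces and cells.} An irreducible Grassmann necklace of type $(k,n)$ is a sequence $\mathcal I=(I_1,\dots,I_n)$ of $k$-element subsets of $[n]$ such that for every $i$ (indices modulo $n$) one has $i\in I_i$ and $I_{i+1}=(I_i\setminus\{i\})\cup\{j\}$ for some $j\ne i$; its permutation $\pi(\mathcal I)$ is defined by $\pi(j)=i$ for these $i,j$. For a $k\times n$ matrix $A$ let $\Delta_I(A)$ be its maximal minor in the column set $I$. For a set $\mathcal M$ of $k$-element subsets of $[n]$, the positroid cell $S_{\mathcal M}^{tnn}$ consists of the points of the Grassmannian represented by full-rank real $k\times n$ matrices $A$ with $\Delta_I(A)>0$ for $I\in\mathcal M$ and $\Delta_J(A)=0$ for $J\notin\mathcal M$. For a derangement $\pi$ of $[n]$, $S_\pi^{tnn}$ is the cell $S_{\mathcal M}^{tnn}$ for which the sets $I_r$ = the lexicographically minimal member of $\mathcal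 M$ for the order $r<r+1<\dots<n<1<\dots<r-1$ form an irreducible Grassmann necklace $\mathcal I(\mathcal M)$ with $\pi(\mathcal I(\mathcal M))=\pi$. It is called a TP Schubert cell if $\pi^{-1}$ has at most one descent. \emph{Contour plots.} For $j\in[n]$ put $E_j(x,y,t)=\exp(\kappa_jx+\kappa_j^2y+\kappa_j^3t)$, and for a $k$-element set $J\subseteq[n]$ put $K_J=\prod_{i<j;\ i,j\in J}(\kappa_j-\kappa_i)$ and $E_J=K_J\prod_{j\in J}E_j$. For $A$ with all $\Delta_J(A)\ge 0$, let $\mathcal M=\{J:\Delta_J(A)\neq 0\}$ and $$f_A(x,y,t)=\max_{J\in\mathcal M}\Big\{\ln(\Delta_J(A)K_J)+\sum_{j\in J}(\kappa_jx+\kappa_j^2y+\kappa_j^3t)\Big\}.$$ The contour plot $\mathcal C_{t_0}(u_A)\subset\mathbb R^2$ is the set of points $(x,y)$ near which $f_A(\cdot,\cdot,t_0)$ is not an affine function. Its regions are the connected components of its complement; the dominant exponential of a region is the exponential $\Delta_J(A)E_J$, $J\in\mathcal M$, of the $\tau$-function $\tau_A=\sum_J\Delta_J(A)E_J$ that is maximal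 among all these on the region at $t=t_0$, and $J$ is its index set. \emph{Theorem.} Let $A$ be (a matrix with non-negative maximal minors representing) an element of a TP Schubert cell $S_\pi^{tnn}$, where $\pi$ is a derangement of $[n]$, and let $t_0\in\mathbb R$ be arbitrary. Then $\mathcal C_{t_0}(u_A)$ has exactly $n$ unbounded regions, they can be listed counterclockwise starting from the region at $x\ll 0$ (so that they contain the far parts of rays from the origin at angles $\pi_0=\theta_1<\theta_2<\dots<\theta_n<3\pi_0$, where $\pi_0=3.14159\ldots$), and if $R_1,\dots,R_n$ are the index sets of their dominant exponentials in this order, then $(R_1,\dots,R_n)$ is an irreducible Grassmann necklace $\mathcal I$ and $\pi(\mathcal I)=\pi$. -/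

import Mathlib

open Set Filter Topology

noncomputable section

namespace KPSoliton

/-- The `k`-element subsets of `[n]`; the elements `1, …, n` are the elements `0, …, n - 1`
of `Fin n`. -/
abbrev KSubset (k n : ℕ) : Type := {I : Finset (Fin n) // I.card = k}

/-! ### Minors and positroid cells -/

/-- The maximal minor of `A` located in the column set `I` (columns in increasing order). -/
def minor {k n : ℕ} (A : Matrix (Fin k) (Fin n) ℝ) (I : KSubset k n) : ℝ :=
  (A.submatrix id (I.1.orderEmbOfFin I.2)).det

/-- The column sets of the nonzero maximal minors of `A`. -/
def matroid {k n : ℕ} (A : Matrix (Fin k) (Fin n) ℝ) : Set (KSubset k n) :=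
  {I | minor A I ≠ 0}

/-- The matrices that represent the points of the positroid cell of `M`: full-rank `k × n`
matrices whose minors are positive on `M` and zero off `M`. -/
def positroidCell {k n : ℕ} (M : Set (KSubset k n)) : Set (Matrix (Fin k) (Fin n) ℝ) :=
  {A | A.rank = k ∧ (∀ I ∈ M, 0 < minor A I) ∧ ∀ J ∉ M, minor A J = 0}

/-! ### Grassmann necklaces and permutations -/

/-- The set `I` written as an increasing word for the order `r < r + 1 < ⋯ < n < 1 < ⋯ < r - 1`:
an element `j` is recorded by its position `j - r` (computed modulo `n`) in that order, and words
are compared lexicographically. -/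
def shiftedWord {k n : ℕ} [NeZero n] (r : Fin n) (I : KSubset k n) : Lex (Fin k → Fin n) :=
  toLex ((I.1.image (fun j => j - r)).orderEmbOfFin
    ((Finset.card_image_of_injective _ sub_left_injective).trans I.2))

/-- `I r` is the lexicographically minimal member of `M` for the order that starts at `r`. -/
def IsLexMinSequence {k n : ℕ} [NeZero n] (M : Set (KSubset k n)) (I : Fin n → KSubset k n) :
    Prop :=
  ∀ r, I r ∈ M ∧ ∀ J ∈ M, shiftedWord r (I r) ≤ shiftedWord r J

/-- Irreducible Grassmann necklaces of type `(k, n)`. In `Fin n`, the successor `i + 1` is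
taken modulo `n`. -/
def IsIrreducibleNecklace {k n : ℕ} [NeZero n] (I : Fin n → KSubset k n) : Prop :=
  ∀ i, i ∈ (I i).1 ∧ ∃ j, j ≠ i ∧ (I (i + 1)).1 = insert j ((I i).1.erase i)

/-- `π` is the permutation `π(I)` of the necklace `I`:
`π j = i` whenever `I (i + 1) = (I i \ {i}) ∪ {j}` with `j ≠ i`. -/
def IsNecklacePerm {k n : ℕ} [NeZero n] (I : Fin n → KSubset k n) (π : Equiv.Perm (Fin n)) :
    Prop :=
  ∀ i j, j ≠ i → (I (i + 1)).1 = insert j ((I i).1.erase i) → π j = i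

/-- The matrices that represent the points of the irreducible positroid cell indexed by `π`:
the cell of `M`, where `π` is the permutation of the (irreducible) necklace of `M`. -/
def permCell (k : ℕ) {n : ℕ} [NeZero n] (π : Equiv.Perm (Fin n)) :
    Set (Matrix (Fin k) (Fin n) ℝ) :=
  {A | ∃ (M : Set (KSubset k n)) (I : Fin n → KSubset k n), A ∈ positroidCell M ∧
    IsLexMinSequence M I ∧ IsIrreducibleNecklace I ∧ IsNecklacePerm I π}

/-- The positions `i` (with `i + 1` still in `[n]`) such that `σ i > σ (i + 1)`. -/
def descents {n : ℕ} (σ : Equiv.Perm (Fin n)) : Set (Fin n) :=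
  {i | ∃ h : (i : ℕ) + 1 < n, σ ⟨(i : ℕ) + 1, h⟩ < σ i}

/-- The permutations that index the totally positive Schubert cells: derangements `π` such that
`π⁻¹` has at most one descent. -/
def IsTPSchubertPerm {n : ℕ} (π : Equiv.Perm (Fin n)) : Prop :=
  (∀ i, π i ≠ i) ∧ (descents π⁻¹).ncard ≤ 1

/-! ### Exponentials of the tau-function and contour plots -/

/-- For each `d` with `2 ≤ d ≤ k`, the sums of the parameters over the `d`-element subsets
of `[n]` are pairwise distinct. -/
def GenericParameters (k : ℕ) {n : ℕ} (κ : Fin n → ℝ) : Prop :=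
  ∀ d, 2 ≤ d → d ≤ k → ∀ I J : Finset (Fin n), I.card = d → J.card = d →
    ∑ i ∈ I, κ i = ∑ j ∈ J, κ j → I = J

/-- The exponential `E_j = exp (κ_j x + κ_j² y + κ_j³ t)`. -/
def expo {n : ℕ} (κ : Fin n → ℝ) (j : Fin n) (x y t : ℝ) : ℝ :=
  Real.exp (κ j * x + κ j ^ 2 * y + κ j ^ 3 * t)

/-- The Vandermonde product `K_J = ∏_{l < m} (κ_{j_m} - κ_{j_l})`. -/
def vdm {k n : ℕ} (κ : Fin n → ℝ) (J : KSubset k n) : ℝ :=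
  ∏ i ∈ J.1, ∏ j ∈ J.1.filter (fun j => i < j), (κ j - κ i)

/-- `E_J = K_J ∏_{j ∈ J} E_j`, the Wronskian of the `E_j`, `j ∈ J`. The tau-function of `A` is
the sum of the `minor A J * expoSet κ J` over all `J`. -/
def expoSet {k n : ℕ} (κ : Fin n → ℝ) (J : KSubset k n) (x y t : ℝ) : ℝ :=
  vdm κ J * ∏ j ∈ J.1, expo κ j x y t

/-- The logarithm of the term `minor A J * expoSet κ J` (for a positive minor). -/
def phase {k n : ℕ} (κ : Fin n → ℝ) (A : Matrix (Fin k) (Fin n) ℝ) (J : KSubset k n)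
    (x y t : ℝ) : ℝ :=
  Real.log (minor A J * vdm κ J) + ∑ j ∈ J.1, (κ j * x + κ j ^ 2 * y + κ j ^ 3 * t)

/-- The function `f_A`, the maximum of the phases (a maximum over a finite set). -/
def maxPhase {k n : ℕ} (κ : Fin n → ℝ) (A : Matrix (Fin k) (Fin n) ℝ) (x y t : ℝ) : ℝ :=
  ⨆ J : matroid A, phase κ A J.1 x y t

/-- The contour plot at time `t₀`: the points `(x, y)` near which `f_A(·, ·, t₀)` is not
linear (that is, does not agree with an affine function of `(x, y)`). -/
def contourPlot {k n : ℕ} (κ : Fin n → ℝ) (A : Matrix (Fin k) (Fin n) ℝ) (t₀ : ℝ) :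
    Set (ℝ × ℝ) :=
  {p | ¬ ∃ a b c : ℝ, ∀ᶠ q : ℝ × ℝ in 𝓝 p, maxPhase κ A q.1 q.2 t₀ = a * q.1 + b * q.2 + c}

/-- The unbounded connected components of the complement of a planar set `C`. -/
def unboundedRegions (C : Set (ℝ × ℝ)) : Set (Set (ℝ × ℝ)) :=
  {U | (∃ p ∈ Cᶜ, U = connectedComponentIn Cᶜ p) ∧ ¬ Bornology.IsBounded U}

/-- `U` lists all unbounded regions of the complement of `C`, each once, counterclockwise, the
first one being the region at `x ≪ 0`: the region `U r` contains the far part of the ray from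
the origin at angle `θ r`, and `π = θ 0 < θ 1 < ⋯ < 3 π`. -/
def IsCounterclockwiseListing {n : ℕ} [NeZero n] (C : Set (ℝ × ℝ)) (U : Fin n → Set (ℝ × ℝ)) :
    Prop :=
  Function.Injective U ∧ Set.range U = unboundedRegions C ∧
    ∃ θ : Fin n → ℝ, StrictMono θ ∧ θ 0 = Real.pi ∧ (∀ r, θ r < 3 * Real.pi) ∧
      ∀ r, ∀ᶠ s : ℝ in atTop, (s * Real.cos (θ r), s * Real.sin (θ r)) ∈ U r

/-- `J` is the index set of a dominant exponential of the tau-function on `U` at time `t₀`. -/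
def IsDominantOn {k n : ℕ} (κ : Fin n → ℝ) (A : Matrix (Fin k) (Fin n) ℝ) (t₀ : ℝ)
    (U : Set (ℝ × ℝ)) (J : KSubset k n) : Prop :=
  J ∈ matroid A ∧ ∀ p ∈ U, ∀ I ∈ matroid A,
    minor A I * expoSet κ I p.1 p.2 t₀ ≤ minor A J * expoSet κ J p.1 p.2 t₀

/-- `R` is the sequence of the index sets of the dominant exponentials of the unbounded regions
of the contour plot, read counterclockwise from the region at `x ≪ 0`. -/
def IsUnboundedLabelling {k n : ℕ} [NeZero n] (κ : Fin n → ℝ) (A : Matrix (Fin k) (Fin n) ℝ)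
    (t₀ : ℝ) (R : Fin n → KSubset k n) : Prop :=
  ∃ U : Fin n → Set (ℝ × ℝ), IsCounterclockwiseListing (contourPlot κ A t₀) U ∧
    ∀ r, IsDominantOn κ A t₀ (U r) (R r)

end KPSoliton

end

open KPSoliton

namespace KPSoliton

/-! ### Exchange between bases of the column matroid -/

/-! Far from the origin the constant terms of the phases, which alone contain t₀, are negligible. So
the unbounded regions are governed by the bases J that maximise, for a direction v = (x, y), the sum
over J of the weights w(j) = κ_j x + κ_j² y.

A basis that meets every superlevel set {c ≤ w} in as many elements as any other basis is optimal
(`sum_le_of_card_filter_le`). Since w is quadratic in κ_j, these sets are intervals for y ≤ 0 and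
complements of intervals for y ≥ 0, hence cyclic intervals; by basis exchange, the lexicographic
minimum I_a meets each cyclic interval starting at a maximally (`card_inter_le_of_isLexMin`).

Put σ = π⁻¹, so that I_{i+1} arises from I_i by exchanging i for σ i. The descent of the derangement
σ cuts [n] into a block that σ raises and a block that it lowers, and σ increases on both. Hence κ_i
+ κ_{σ i} increases on each block, and the directions in which w(i) = w(σ i) occur in the order of i
as v turns counterclockwise from the negative x-axis: the first block in the lower half plane, the
second in the upper one. For v between the critical directions of r - 1 and r, the exchanges between
I_a and I_r cannot make the intersection with a superlevel set smaller at I_r than at I_a, so I_r is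
optimal (`card_inter_le_of_interval`, `card_inter_le_of_interval_compl`).

By genericity a tie w(a) = w(b) determines the pair {a, b}, so in a critical direction only two
consecutive necklace members are optimal. Thus any other basis loses in every direction
(`exists_linPart_lt`), and by compactness its region is bounded. -/

theorem linearIndepOn_iff_minor_ne_zero {k n : ℕ} (A : Matrix (Fin k) (Fin n) ℝ)
    (I : KSubset k n) :
    LinearIndepOn ℝ (fun j => A.col j) (I.1 : Set (Fin n)) ↔ minor A I ≠ 0 := by
  unfold minor
  rw [← isUnit_iff_ne_zero, ← Matrix.isUnit_iff_isUnit_det,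
    ← Matrix.linearIndependent_cols_iff_isUnit, LinearIndepOn]
  rw [← linearIndependent_equiv (I.1.orderIsoOfFin I.2).toEquiv]
  rfl

theorem card_le_of_linearIndepOn {k n : ℕ} (v : Fin n → Fin k → ℝ) (S X : Finset (Fin n))
    (hS : LinearIndepOn ℝ v (S : Set (Fin n))) (h : v '' S ⊆ Submodule.span ℝ (v '' X)) :
    S.card ≤ X.card := by
  classical
  have h1 := linearIndependent_le_span' (fun x : (S : Set (Fin n)) => v x) hS
    ((X.image v : Finset (Fin k → ℝ)) : Set (Fin k → ℝ)) (by
      rintro _ ⟨x, rfl⟩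
      rw [Finset.coe_image]
      exact h (mem_image_of_mem v x.2))
  have h2 : S.card ≤ (X.image v).card := by simpa using h1
  exact h2.trans Finset.card_image_le

/-- The independent set J ∩ T is too large for S ∩ T to span the columns of T, so some j ∈ T
enlarges S ∩ T. Completing S ∩ T with j to a basis inside S ∪ {j} leaves out exactly one b, which
lies outside T. -/
theorem exists_exchange {k n : ℕ} (A : Matrix (Fin k) (Fin n) ℝ) (S J : KSubset k n)
    (hS : S ∈ matroid A) (hJ : J ∈ matroid A) (T : Finset (Fin n))
    (h : (S.1 ∩ T).card < (J.1 ∩ T).card) :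
    ∃ B ∈ matroid A, ∃ j ∈ T, ∃ b ∈ S.1, j ∉ S.1 ∧ b ∉ T ∧ B.1 = insert j (S.1.erase b) := by
  classical
  have hS' := (linearIndepOn_iff_minor_ne_zero A S).2 hS
  have hJ' := (linearIndepOn_iff_minor_ne_zero A J).2 hJ
  set v : Fin n → Fin k → ℝ := fun j => A.col j
  have h1 : LinearIndepOn ℝ v (↑(S.1 ∩ T) : Set (Fin n)) := hS'.mono (by simp)
  have h2 : LinearIndepOn ℝ v (↑(J.1 ∩ T) : Set (Fin n)) := hJ'.mono (by simp)
  obtain ⟨X, hXT, hSX, hX, hXi⟩ := exists_linearIndepOn_extension h1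
    (t := (T : Set (Fin n))) (by simp)
  obtain ⟨j, hjX, hj⟩ : ∃ j ∈ X, j ∉ S.1 ∩ T := by
    by_contra! hc
    have := card_le_of_linearIndepOn v (J.1 ∩ T) (S.1 ∩ T) h2 (by
      refine (image_mono ?_).trans (hX.trans (Submodule.span_mono (image_mono ?_)))
      · simp
      · intro x hx; exact hc x hx)
    omega
  have hjT : j ∈ T := hXT hjX
  have hjS : j ∉ S.1 := fun h => hj (Finset.mem_inter.2 ⟨h, hjT⟩)
  have h3 : LinearIndepOn ℝ v (↑(insert j (S.1 ∩ T)) : Set (Fin n)) := hXi.mono (by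
    rw [Finset.coe_insert]; exact insert_subset hjX hSX)
  obtain ⟨Y, hYS, hSY, hY, hYi⟩ := exists_linearIndepOn_extension h3
    (t := (↑(insert j S.1) : Set (Fin n)))
    (by exact_mod_cast Finset.insert_subset_insert _ Finset.inter_subset_left)
  lift Y to Finset (Fin n) using Y.toFinite
  have hYc1 : k ≤ Y.card := by
    have := card_le_of_linearIndepOn v S.1 Y hS' ((image_mono (by simp)).trans hY)
    rwa [S.2] at this
  have hYc2 : Y.card ≤ k := by
    have := hYi.linearIndependent.fintype_card_le_finrank
    simpa using this
  have hYc : Y.card = k := le_antisymm hYc2 hYc1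
  have hYS' : Y ⊆ insert j S.1 := by exact_mod_cast hYS
  have hSY' : insert j (S.1 ∩ T) ⊆ Y := by exact_mod_cast hSY
  have hjY : j ∈ Y := hSY' (by simp)
  obtain ⟨b, hbS, hbY⟩ : ∃ b ∈ S.1, b ∉ Y := by
    by_contra! hc
    have : (insert j S.1).card ≤ Y.card := Finset.card_le_card (Finset.insert_subset hjY hc)
    rw [Finset.card_insert_of_notMem hjS, S.2] at this
    omega
  refine ⟨⟨Y, hYc⟩, (linearIndepOn_iff_minor_ne_zero A ⟨Y, hYc⟩).1 hYi, j, hjT, b, hbS, hjS, ?_, ?_⟩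
  · intro hbT
    exact hbY (hSY' (by simp [hbS, hbT]))
  · refine Finset.eq_of_subset_of_card_le ?_ ?_
    · intro x hx
      have := hYS' hx
      simp only [Finset.mem_insert, Finset.mem_erase] at this ⊢
      rcases this with h | h
      · exact Or.inl h
      · exact Or.inr ⟨fun hb => hbY (hb ▸ hx), h⟩
    · rw [Finset.card_insert_of_notMem (by simp [hjS]), Finset.card_erase_of_mem hbS, S.2]
      have : 0 < S.1.card := Finset.card_pos.2 ⟨b, hbS⟩
      rw [S.2] at this
      simp only [hYc]
      omega

/-! ### Lexicographic minima are dominating -/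

/-- If the word of S were smaller, its entry at the first difference would be missing from B, hence
be b. But j < b occurs in B before that position, where the two words agree, so j would lie in S. -/
theorem toLex_orderEmbOfFin_lt {k n : ℕ} (S B : Finset (Fin n)) (hS : S.card = k)
    (hB : B.card = k) (j b : Fin n) (hj : j ∉ S) (hjb : j < b)
    (h : B = insert j (S.erase b)) :
    toLex (⇑(B.orderEmbOfFin hB)) < toLex (⇑(S.orderEmbOfFin hS)) := by
  set u := B.orderEmbOfFin hB with hu
  set v := S.orderEmbOfFin hS with hv
  have hur : ∀ x, x ∈ B ↔ ∃ p, u p = x := fun x => by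
    have := Finset.range_orderEmbOfFin B hB
    rw [← Finset.mem_coe, ← this]; rfl
  have hvr : ∀ x, x ∈ S ↔ ∃ p, v p = x := fun x => by
    have := Finset.range_orderEmbOfFin S hS
    rw [← Finset.mem_coe, ← this]; rfl
  rcases lt_trichotomy (toLex (⇑u)) (toLex (⇑v)) with hlt | heq | hgt
  · exact hlt
  · exfalso
    have : ⇑u = ⇑v := toLex.injective heq
    apply hj
    rw [hvr, ← this, ← hur, h]
    simp
  · exfalso
    obtain ⟨p, hp, hlt⟩ := hgt
    simp only [Pi.toLex_apply] at hp hlt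
    have hvB : v p ∉ B := by
      rw [hur]
      rintro ⟨q, hq⟩
      rcases lt_or_ge q p with hqp | hqp
      · rw [← hp q hqp] at hq
        exact hqp.ne (v.injective hq)
      · have := u.monotone hqp
        rw [hq] at this
        exact absurd hlt (not_lt.2 this)
    have hvb : v p = b := by
      have : v p ∈ S := (hvr _).2 ⟨p, rfl⟩
      rw [h] at hvB
      simp only [Finset.mem_insert, Finset.mem_erase, not_or, not_and] at hvB
      by_contra hne
      exact hvB.2 hne this
    obtain ⟨q, hq⟩ := (hur j).1 (by rw [h]; simp)
    have hqp : q < p := by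
      rw [← u.lt_iff_lt, hq]
      exact hjb.trans (hvb ▸ hlt)
    apply hj
    rw [← hq, ← hp q hqp]
    exact (hvr _).2 ⟨q, rfl⟩

theorem shiftedWord_lt {k n : ℕ} [NeZero n] (r : Fin n) (S B : KSubset k n) (j b : Fin n)
    (hj : j ∉ S.1) (hjb : j - r < b - r) (h : B.1 = insert j (S.1.erase b)) :
    shiftedWord r B < shiftedWord r S := by
  have hinj : Function.Injective (fun j : Fin n => j - r) := sub_left_injective
  refine toLex_orderEmbOfFin_lt _ _ _ _ (j - r) (b - r) ?_ hjb ?_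
  · rw [Finset.mem_image]
    rintro ⟨x, hx, hxe⟩
    exact hj (hinj hxe ▸ hx)
  · rw [h, Finset.image_insert, Finset.image_erase hinj]

/-- T is an initial segment of the order starting at `a`. An exchange that brings in an element of T
for one outside T would lower the word of the minimum. -/
theorem card_inter_le_of_isLexMin {k n : ℕ} [NeZero n] (A : Matrix (Fin k) (Fin n) ℝ)
    (I : Fin n → KSubset k n) (hI : IsLexMinSequence (matroid A) I) (a : Fin n)
    (T : Finset (Fin n)) (hT : ∀ x ∈ T, ∀ y ∉ T, x - a < y - a) (J : KSubset k n)
    (hJ : J ∈ matroid A) : (J.1 ∩ T).card ≤ ((I a).1 ∩ T).card := by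
  by_contra! hc
  obtain ⟨B, hB, j, hjT, b, -, hjS, hbT, hBe⟩ := exists_exchange A (I a) J (hI a).1 hJ T hc
  exact absurd ((hI a).2 B hB) (not_le.2 (shiftedWord_lt a (I a) B j b hjS (hT j hjT b hbT) hBe))

section

/-! ### Comparison of weights through superlevel sets -/

/-- Remove a heaviest element from each set. Up to the level `w b` both counts drop by one, and
above it J has no elements, so the hypothesis survives. Equal sums force equality at every removal.
-/
theorem sum_le_of_card_filter_le {ι : Type*} [DecidableEq ι] (w : ι → ℝ) (d : ℕ) :
    ∀ I J : Finset ι, I.card = d → J.card = d →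
      (∀ c, (J.filter (fun j => c ≤ w j)).card ≤ (I.filter (fun j => c ≤ w j)).card) →
      ∑ j ∈ J, w j ≤ ∑ j ∈ I, w j ∧ (∑ j ∈ I, w j ≤ ∑ j ∈ J, w j →
        ∀ c, (I.filter (fun j => c ≤ w j)).card = (J.filter (fun j => c ≤ w j)).card) := by
  induction d with
  | zero =>
    intro I J hI hJ _
    rw [Finset.card_eq_zero] at hI hJ
    subst hI hJ
    simp
  | succ d ih =>
    intro I J hI hJ h
    obtain ⟨a, haI, ha⟩ := I.exists_max_image w (Finset.card_pos.1 (by omega))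
    obtain ⟨b, hbJ, hb⟩ := J.exists_max_image w (Finset.card_pos.1 (by omega))
    have hba : w b ≤ w a := by
      have h1 : 0 < (J.filter (fun j => w b ≤ w j)).card :=
        Finset.card_pos.2 ⟨b, by simp [hbJ]⟩
      obtain ⟨x, hx⟩ := Finset.card_pos.1 (h1.trans_le (h (w b)))
      rw [Finset.mem_filter] at hx
      exact hx.2.trans (ha x hx.1)
    have key : ∀ (K : Finset ι) (z : ι), z ∈ K → ∀ c,
        (K.filter (fun j => c ≤ w j)).card =
          ((K.erase z).filter (fun j => c ≤ w j)).card + if c ≤ w z then 1 else 0 := by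
      intro K z hz c
      conv_lhs => rw [← Finset.insert_erase hz]
      rw [Finset.filter_insert]
      split_ifs with hc
      · rw [Finset.card_insert_of_notMem (by simp)]
      · simp
    obtain ⟨ih1, ih2⟩ := ih (I.erase a) (J.erase b)
      (by rw [Finset.card_erase_of_mem haI, hI]; rfl)
      (by rw [Finset.card_erase_of_mem hbJ, hJ]; rfl) (by
        intro c
        by_cases hc : c ≤ w b
        · have := h c
          rw [key I a haI, key J b hbJ, if_pos hc, if_pos (hc.trans hba)] at this
          omega
        · have : (J.erase b).filter (fun j => c ≤ w j) = ∅ := by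
            refine Finset.filter_eq_empty_iff.2 fun x hx hcx => hc (hcx.trans (hb x ?_))
            exact Finset.mem_of_mem_erase hx
          rw [this]
          simp)
    have hIs := Finset.add_sum_erase I w haI
    have hJs := Finset.add_sum_erase J w hbJ
    refine ⟨by linarith, fun hle c => ?_⟩
    have h1 := ih2 (by linarith) c
    have h2 : w b = w a := by linarith
    rw [key I a haI, key J b hbJ, h1, h2]

/-! ### Permutations with one descent -/

/-- `σ` is a fixed-point free permutation that increases on `{i | i < m}` and on
`{i | m ≤ i}`; it raises the elements of the first block and lowers those of the second one. -/
structure IsOneDescentDerangement {n : ℕ} (σ : Equiv.Perm (Fin n)) (m : ℕ) : Prop where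
  lt_card : m < n
  lt_apply : ∀ i : Fin n, i.1 < m → i < σ i
  apply_lt : ∀ i : Fin n, m ≤ i.1 → σ i < i
  mono_left : ∀ i j : Fin n, j.1 < m → i < j → σ i < σ j
  mono_right : ∀ i j : Fin n, m ≤ i.1 → i < j → σ i < σ j

theorem strictMono_segment {n : ℕ} (σ : Equiv.Perm (Fin n)) (p q : ℕ)
    (h : ∀ i, p ≤ i → ∀ hi : i + 1 < n, i + 1 < q → σ ⟨i, by omega⟩ < σ ⟨i + 1, hi⟩)
    (i j : Fin n) (hp : p ≤ i.1) (hq : j.1 < q) (hij : i < j) : σ i < σ j := by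
  obtain ⟨i, hi⟩ := i
  obtain ⟨j, hj⟩ := j
  simp only [Fin.mk_lt_mk] at hp hq hij
  induction j, hij using Nat.le_induction with
  | base => exact h i hp hj hq
  | succ j hij ih => exact (ih (by omega) (by omega)).trans (h j (by omega) hj hq)

/-- The blocks are cut after the descent. Strict growth gives i ≤ σ i by induction from the bottom
of the first block and σ i ≤ i by induction from the top of the second; the absence of fixed points
makes both strict. -/
theorem exists_isOneDescentDerangement {n : ℕ} [NeZero n] (π : Equiv.Perm (Fin n))
    (hπ : IsTPSchubertPerm π) : ∃ m, IsOneDescentDerangement π⁻¹ m := by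
  obtain ⟨hd, hc⟩ := hπ
  set σ := π⁻¹ with hσ
  have hfix : ∀ i, σ i ≠ i := by
    intro i hi
    apply hd i
    rw [hσ, Equiv.Perm.inv_eq_iff_eq] at hi
    exact hi.symm
  have hsub : ∀ i j, i ∈ descents σ → j ∈ descents σ → i = j := by
    rw [Set.ncard_le_one] at hc
    exact fun i j hi hj => hc i hi j hj
  have hmono : ∃ m, m < n ∧ (∀ i j : Fin n, j.1 < m → i < j → σ i < σ j) ∧
      (∀ i j : Fin n, m ≤ i.1 → i < j → σ i < σ j) := by
    have hnd : ∀ i (hi : i + 1 < n), (⟨i, by omega⟩ : Fin n) ∉ descents σ →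
        σ ⟨i, by omega⟩ < σ ⟨i + 1, hi⟩ := by
      intro i hi h
      by_contra hle
      refine h ⟨hi, lt_of_le_of_ne (not_lt.1 hle) ?_⟩
      intro he
      have := σ.injective he
      simp at this
    rcases (descents σ).eq_empty_or_nonempty with he | ⟨d, hdd⟩
    · refine ⟨0, Nat.pos_of_neZero n, fun i j h => absurd h (by omega), ?_⟩
      intro i j _ hij
      refine strictMono_segment σ 0 n ?_ i j (by omega) j.2 hij
      intro i _ hi _
      exact hnd i hi (by simp [he])
    · obtain ⟨hdn, _⟩ := id hdd
      refine ⟨d.1 + 1, hdn, ?_, ?_⟩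
      · intro i j hj hij
        refine strictMono_segment σ 0 (d.1 + 1) ?_ i j (by omega) hj hij
        intro i _ hi hid
        refine hnd i hi fun hm => ?_
        have := congrArg Fin.val (hsub _ _ hm hdd)
        simp at this
        omega
      · intro i j hj hij
        refine strictMono_segment σ (d.1 + 1) n ?_ i j hj j.2 hij
        intro i hid hi _
        refine hnd i hi fun hm => ?_
        have := congrArg Fin.val (hsub _ _ hm hdd)
        simp at this
        omega
  obtain ⟨m, hmn, h1, h2⟩ := hmono
  refine ⟨m, hmn, ?_, ?_, h1, h2⟩
  · intro i hi
    refine lt_of_le_of_ne ?_ (hfix i).symm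
    obtain ⟨i, hin⟩ := i
    simp only at hi
    induction i with
    | zero => exact Nat.zero_le _
    | succ i ih =>
      have a1 := ih (by omega) (by omega)
      have a2 := h1 ⟨i, by omega⟩ ⟨i + 1, hin⟩ hi (by simp)
      rw [Fin.le_def] at a1 ⊢
      rw [Fin.lt_def] at a2
      simp only at a1 a2 ⊢
      omega
  · intro i hi
    refine lt_of_le_of_ne ?_ (hfix i)
    have : ∀ e, ∀ i : Fin n, m ≤ i.1 → n - 1 - i.1 = e → σ i ≤ i := by
      intro e
      induction e with
      | zero =>
        intro i _ he
        rw [Fin.le_def]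
        have := (σ i).2
        omega
      | succ e ih =>
        intro i hi he
        have a1 := ih ⟨i.1 + 1, by omega⟩ (by simp; omega) (by simp; omega)
        have a2 := h2 i ⟨i.1 + 1, by omega⟩ hi (by rw [Fin.lt_def]; simp)
        rw [Fin.le_def] at a1 ⊢
        rw [Fin.lt_def] at a2
        simp only at a1 a2 ⊢
        omega
    exact this _ i hi rfl

/-! ### Passing along a necklace -/

theorem fin_ofNat_succ {n : ℕ} [NeZero n] (i : ℕ) :
    Fin.ofNat n (i + 1) = Fin.ofNat n i + 1 := by
  apply Fin.ext
  simp [Fin.val_add]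

theorem fin_val_ofNat_of_lt {n : ℕ} [NeZero n] {i : ℕ} (hi : i < n) : (Fin.ofNat n i).1 = i := by
  rw [Fin.val_ofNat, Nat.mod_eq_of_lt hi]

/-- `I` is a necklace of irreducible type along which `i` is replaced by `σ i`. -/
def IsNecklaceAlong {k n : ℕ} [NeZero n] (I : Fin n → KSubset k n) (σ : Equiv.Perm (Fin n)) :
    Prop :=
  ∀ i, i ∈ (I i).1 ∧ σ i ∉ (I i).1 ∧ (I (i + 1)).1 = insert (σ i) ((I i).1.erase i)

theorem isNecklaceAlong_inv {k n : ℕ} [NeZero n] {I : Fin n → KSubset k n}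
    {π : Equiv.Perm (Fin n)} (h1 : IsIrreducibleNecklace I) (h2 : IsNecklacePerm I π) :
    IsNecklaceAlong I π⁻¹ := by
  intro i
  obtain ⟨hi, j, hji, hj⟩ := h1 i
  have hπ : π⁻¹ i = j := by
    rw [Equiv.Perm.inv_eq_iff_eq]
    exact (h2 i j hji hj).symm
  rw [hπ]
  refine ⟨hi, fun hjI => ?_, hj⟩
  have hc := (I (i + 1)).2
  rw [hj, Finset.insert_eq_of_mem (Finset.mem_erase.2 ⟨hji, hjI⟩),
    Finset.card_erase_of_mem hi, (I i).2] at hc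
  have : 0 < (I i).1.card := Finset.card_pos.2 ⟨i, hi⟩
  rw [(I i).2] at this
  omega

namespace IsNecklaceAlong

variable {k n : ℕ} [NeZero n] {I : Fin n → KSubset k n} {σ : Equiv.Perm (Fin n)}

theorem card_inter_add (h : IsNecklaceAlong I σ) (T : Finset (Fin n)) (i : Fin n) :
    ((I (i + 1)).1 ∩ T).card + (if i ∈ T then 1 else 0) =
      ((I i).1 ∩ T).card + (if σ i ∈ T then 1 else 0) := by
  obtain ⟨h1, h2, h3⟩ := h i
  have e1 : ((I i).1 ∩ T).card = (((I i).1.erase i) ∩ T).card + if i ∈ T then 1 else 0 := by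
    conv_lhs => rw [← Finset.insert_erase h1]
    split_ifs with hT
    · rw [Finset.insert_inter_of_mem hT, Finset.card_insert_of_notMem (by simp)]
    · rw [Finset.insert_inter_of_notMem hT]; simp
  have e2 : ((I (i + 1)).1 ∩ T).card =
      (((I i).1.erase i) ∩ T).card + if σ i ∈ T then 1 else 0 := by
    rw [h3]
    split_ifs with hT
    · rw [Finset.insert_inter_of_mem hT, Finset.card_insert_of_notMem (by simp [h2])]
    · rw [Finset.insert_inter_of_notMem hT]; simp
  rw [e1, e2]
  ring

theorem card_inter_mono (h : IsNecklaceAlong I σ) (T : Finset (Fin n)) (p q : ℕ) (hpq : p ≤ q)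
    (hT : ∀ i : ℕ, p ≤ i → i < q → (Fin.ofNat n i) ∈ T → σ (Fin.ofNat n i) ∈ T) :
    ((I (Fin.ofNat n p)).1 ∩ T).card ≤ ((I (Fin.ofNat n q)).1 ∩ T).card := by
  induction q, hpq using Nat.le_induction with
  | base => exact le_rfl
  | succ q hpq ih =>
    have h1 := ih fun i hi hiq => hT i hi (by omega)
    have h2 := h.card_inter_add T (Fin.ofNat n q)
    have h3 := hT q hpq (by omega)
    rw [fin_ofNat_succ]
    split_ifs at h2 <;> first | omega | tauto

theorem card_inter_anti (h : IsNecklaceAlong I σ) (T : Finset (Fin n)) (p q : ℕ) (hpq : p ≤ q)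
    (hT : ∀ i : ℕ, p ≤ i → i < q → σ (Fin.ofNat n i) ∈ T → (Fin.ofNat n i) ∈ T) :
    ((I (Fin.ofNat n q)).1 ∩ T).card ≤ ((I (Fin.ofNat n p)).1 ∩ T).card := by
  induction q, hpq using Nat.le_induction with
  | base => exact le_rfl
  | succ q hpq ih =>
    have h1 := ih fun i hi hiq => hT i hi (by omega)
    have h2 := h.card_inter_add T (Fin.ofNat n q)
    have h3 := hT q hpq (by omega)
    rw [fin_ofNat_succ]
    split_ifs at h2 <;> first | omega | tauto

end IsNecklaceAlong

/-! ### Maximal intersections with intervals and their complements. -/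

variable {k n : ℕ} [NeZero n] {A : Matrix (Fin k) (Fin n) ℝ} {I : Fin n → KSubset k n}
  {σ : Equiv.Perm (Fin n)} {m : ℕ}

/-- The set `I r` has the largest possible intersection with an interval `T`, if the
exchanges of the first block before `r` do not leave `T` and those after `r` do not enter it. -/
theorem card_inter_le_of_interval (hI : IsLexMinSequence (matroid A) I)
    (hN : IsNecklaceAlong I σ) (hσ : IsOneDescentDerangement σ m) (r : ℕ) (hr : r ≤ m)
    (T : Finset (Fin n)) (hT : ∀ a b c : Fin n, a < b → b < c → a ∈ T → c ∈ T → b ∈ T)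
    (h1 : ∀ i : Fin n, i.1 < r → i ∈ T → σ i ∈ T)
    (h2 : ∀ i : Fin n, r ≤ i.1 → i.1 < m → σ i ∈ T → i ∈ T)
    (J : KSubset k n) (hJ : J ∈ matroid A) :
    (J.1 ∩ T).card ≤ ((I (Fin.ofNat n r)).1 ∩ T).card := by
  have hmn := hσ.lt_card
  rcases T.eq_empty_or_nonempty with rfl | hne
  · simp
  set a := T.min' hne with ha
  have haT : a ∈ T := T.min'_mem hne
  have hamin : ∀ x ∈ T, a ≤ x := fun x hx => T.min'_le x hx
  -- In the order starting at the minimum `a` of T, the elements below `a` come last, so the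
  -- interval T is an initial segment.
  have hrank : (J.1 ∩ T).card ≤ ((I a).1 ∩ T).card := by
    refine card_inter_le_of_isLexMin A I hI a T ?_ J hJ
    intro x hx y hy
    have hax := hamin x hx
    rcases lt_or_ge y a with hya | hya
    · rw [Fin.lt_def, Fin.sub_val_of_le hax, Fin.coe_sub_iff_lt.2 hya]
      have := x.2; have := a.2
      omega
    · rw [Fin.lt_def, Fin.sub_val_of_le hax, Fin.sub_val_of_le hya]
      have : x < y := by
        by_contra hxy
        have hyx : y < x := lt_of_le_of_ne (not_lt.1 hxy) fun he => hy (he ▸ hx)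
        have hay : a < y := lt_of_le_of_ne hya fun he => hy (he ▸ haT)
        exact hy (hT a y x hay hyx haT hx)
      rw [Fin.lt_def] at this
      rw [Fin.le_def] at hax
      omega
  refine hrank.trans ?_
  have hcast : Fin.ofNat n a.1 = a := by simp
  rw [← hcast]
  -- The bound passes from `I a` to `I r`. Steps in the first block are covered by the hypotheses; a
  -- second-block step before `a` brings in an element below `a`, hence outside T.
  rcases le_total a.1 r with har | har
  · refine hN.card_inter_mono T _ _ har fun i _ hi => h1 _ ?_
    rwa [fin_val_ofNat_of_lt (by omega)]
  · refine hN.card_inter_anti T _ _ har fun i hri hi hiT => ?_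
    have hin : i < n := hi.trans a.2
    rcases lt_or_ge i m with him | him
    · exact h2 _ (by rwa [fin_val_ofNat_of_lt hin]) (by rwa [fin_val_ofNat_of_lt hin]) hiT
    · exfalso
      have a1 := hσ.apply_lt (Fin.ofNat n i) (by rwa [fin_val_ofNat_of_lt hin])
      have a2 := hamin _ hiT
      rw [Fin.lt_def, fin_val_ofNat_of_lt hin] at a1
      rw [Fin.le_def] at a2
      omega

/-- The set `I r` has the largest possible intersection with the complement `T` of an interval,
if the exchanges of the second block before `r` do not leave `T` and those after `r` do not
enter it. -/
theorem card_inter_le_of_interval_compl (hI : IsLexMinSequence (matroid A) I)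
    (hN : IsNecklaceAlong I σ) (hσ : IsOneDescentDerangement σ m) (r : ℕ)
    (hrn : r ≤ n)
    (T : Finset (Fin n)) (hT : ∀ a b c : Fin n, a < b → b < c → a ∉ T → c ∉ T → b ∉ T)
    (h1 : ∀ i : Fin n, m ≤ i.1 → i.1 < r → i ∈ T → σ i ∈ T)
    (h2 : ∀ i : Fin n, r ≤ i.1 → σ i ∈ T → i ∈ T)
    (J : KSubset k n) (hJ : J ∈ matroid A) :
    (J.1 ∩ T).card ≤ ((I (Fin.ofNat n r)).1 ∩ T).card := by
  rcases Tᶜ.eq_empty_or_nonempty with he | hne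
  · rw [Finset.compl_eq_empty_iff] at he
    subst he
    rw [Finset.inter_univ, Finset.inter_univ, J.2, (I _).2]
  set b := Tᶜ.max' hne with hb
  have hbT : b ∉ T := Finset.mem_compl.1 (Tᶜ.max'_mem hne)
  have hbmax : ∀ x, x ∉ T → x ≤ b := fun x hx => Tᶜ.le_max' x (Finset.mem_compl.2 hx)
  have hsub : ∀ x : Fin n, (x - (Fin.ofNat n (b.1 + 1))).1 =
      if x ≤ b then x.1 + (n - (b.1 + 1)) else x.1 - (b.1 + 1) := by
    intro x
    have hxn := x.2
    have hbn := b.2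
    rw [Fin.sub_def]
    simp only [Fin.val_ofNat]
    -- If `b` is the last element, `b + 1` is 0 modulo n and the shifted order is the usual one.
    rcases eq_or_lt_of_le (Nat.succ_le_of_lt hbn) with hbe | hbe
    · have hxb : x ≤ b := by rw [Fin.le_def]; omega
      have : b.1 + 1 = n := hbe
      rw [if_pos hxb, this]
      simp [Nat.mod_eq_of_lt hxn]
    · rw [Nat.mod_eq_of_lt hbe]
      split_ifs with hxb <;> rw [Fin.le_def] at hxb
      · rw [Nat.mod_eq_of_lt (by omega)]; omega
      · have : n - (b.1 + 1) + x.1 = x.1 - (b.1 + 1) + n := by omega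
        rw [this, Nat.add_mod_right, Nat.mod_eq_of_lt (by omega)]
  have hrank : (J.1 ∩ T).card ≤ ((I (Fin.ofNat n (b.1 + 1))).1 ∩ T).card := by
    refine card_inter_le_of_isLexMin A I hI _ T ?_ J hJ
    intro x hx y hy
    have hyb := hbmax y hy
    rw [Fin.lt_def, hsub, hsub, if_pos hyb]
    have hxn := x.2
    split_ifs with hxb
    · have : x < y := by
        by_contra hxy
        have hyx : y < x := lt_of_le_of_ne (not_lt.1 hxy) fun he => hy (he ▸ hx)
        have hxb' : x < b := lt_of_le_of_ne hxb fun he => hbT (he ▸ hx)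
        exact hT y x b hyx hxb' hy hbT hx
      rw [Fin.lt_def] at this
      omega
    · omega
  refine hrank.trans ?_
  -- A first-block step beyond `b` brings in an element above `b`, which lies in T; this is why `h1`
  -- concerns the second block only.
  rcases le_total (b.1 + 1) r with har | har
  · refine hN.card_inter_mono T _ _ har fun i hbi hi hiT => ?_
    have hin : i < n := by omega
    rcases lt_or_ge i m with him | him
    · by_contra hc
      have a1 := hσ.lt_apply (Fin.ofNat n i) (by rwa [fin_val_ofNat_of_lt hin])
      have a2 := hbmax _ hc
      rw [Fin.lt_def, fin_val_ofNat_of_lt hin] at a1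
      rw [Fin.le_def] at a2
      omega
    · exact h1 _ (by rwa [fin_val_ofNat_of_lt hin]) (by rwa [fin_val_ofNat_of_lt hin]) hiT
  · refine hN.card_inter_anti T _ _ har fun i hri hi hiT => ?_
    have hin : i < n := by have := b.2; omega
    exact h2 _ (by rwa [fin_val_ofNat_of_lt hin]) hiT

end

section

/-! ### Weights of a direction in the plane -/

/-- The rate of growth of the logarithm of `E_j` in the direction `v`. -/
def weight {n : ℕ} (κ : Fin n → ℝ) (v : ℝ × ℝ) (j : Fin n) : ℝ :=
  κ j * v.1 + κ j ^ 2 * v.2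

/-- The rate of growth of the logarithm of `E_J` in the direction `v`. -/
def linPart {k n : ℕ} (κ : Fin n → ℝ) (J : KSubset k n) (v : ℝ × ℝ) : ℝ :=
  ∑ j ∈ J.1, weight κ v j

/-- Every superlevel set of the weights of `v` meets `S` in at least as many elements as it
meets any other basis. -/
def DominatesAt {k n : ℕ} (κ : Fin n → ℝ) (A : Matrix (Fin k) (Fin n) ℝ) (v : ℝ × ℝ)
    (S : KSubset k n) : Prop :=
  ∀ J ∈ matroid A, ∀ c : ℝ, (J.1.filter (fun j => c ≤ weight κ v j)).card ≤
    (S.1.filter (fun j => c ≤ weight κ v j)).card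

theorem weight_sub_weight {n : ℕ} (κ : Fin n → ℝ) (v : ℝ × ℝ) (a b : Fin n) :
    weight κ v a - weight κ v b = (κ a - κ b) * (v.1 + (κ a + κ b) * v.2) := by
  unfold weight; ring

theorem linPart_eq {k n : ℕ} (κ : Fin n → ℝ) (J : KSubset k n) (v : ℝ × ℝ) :
    linPart κ J v = (∑ j ∈ J.1, κ j) * v.1 + (∑ j ∈ J.1, κ j ^ 2) * v.2 := by
  simp only [linPart, weight, Finset.sum_add_distrib, Finset.sum_mul]

theorem continuous_weight {n : ℕ} (κ : Fin n → ℝ) (j : Fin n) :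
    Continuous (fun v => weight κ v j) := by
  unfold weight; fun_prop

variable {k n : ℕ} {A : Matrix (Fin k) (Fin n) ℝ} {κ : Fin n → ℝ}

/-! ### Ties between optimal bases. -/

theorem DominatesAt.linPart_le {v : ℝ × ℝ} {S J : KSubset k n} (h : DominatesAt κ A v S)
    (hJ : J ∈ matroid A) : linPart κ J v ≤ linPart κ S v :=
  (sum_le_of_card_filter_le (weight κ v) k S.1 J.1 S.2 J.2 (h J hJ)).1

theorem card_filter_eq_of_card_filter_le {ι : Type*} [DecidableEq ι] [Fintype ι] (w : ι → ℝ)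
    (I J : Finset ι)
    (h : ∀ c, (I.filter (fun j => c ≤ w j)).card = (J.filter (fun j => c ≤ w j)).card) (c : ℝ) :
    (I.filter (fun j => w j = c)).card = (J.filter (fun j => w j = c)).card := by
  -- A strict superlevel set is empty or the weak superlevel set at the next larger value of `w`.
  have hlt : (I.filter (fun j => c < w j)).card = (J.filter (fun j => c < w j)).card := by
    rcases (Finset.univ.filter (fun j => c < w j)).eq_empty_or_nonempty with he | hne
    · have : ∀ j, ¬ c < w j := fun j => by
        simpa using Finset.filter_eq_empty_iff.1 he (Finset.mem_univ j)
      simp [this]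
    · obtain ⟨z, hz, hmin⟩ := Finset.exists_min_image _ w hne
      have : ∀ j, c < w j ↔ w z ≤ w j := fun j =>
        ⟨fun hj => hmin j (by simp [hj]), fun hj => lt_of_lt_of_le (by simpa using hz) hj⟩
      simp only [this]
      exact h _
  have hsplit : ∀ K : Finset ι, (K.filter (fun j => c ≤ w j)).card =
      (K.filter (fun j => c < w j)).card + (K.filter (fun j => w j = c)).card := by
    intro K
    rw [← Finset.card_union_of_disjoint, ← Finset.filter_or]
    · congr 1
      ext j
      simp only [Finset.mem_filter, le_iff_lt_or_eq, eq_comm]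
    · rw [Finset.disjoint_filter]
      intro j _ h1 h2
      exact h1.ne h2.symm
  have h1 := h c
  rw [hsplit, hsplit] at h1
  omega

/-- When the sums tie, S and J have equally many elements of each weight, so an element of J outside
S has a partner of the same weight in S outside J. -/
theorem DominatesAt.exists_tie {v : ℝ × ℝ} {S J : KSubset k n} (h : DominatesAt κ A v S)
    (hJ : J ∈ matroid A) (hle : linPart κ S v ≤ linPart κ J v) (a : Fin n) (haJ : a ∈ J.1)
    (haS : a ∉ S.1) : ∃ b ∈ S.1, b ∉ J.1 ∧ weight κ v b = weight κ v a := by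
  have h1 := (sum_le_of_card_filter_le (weight κ v) k S.1 J.1 S.2 J.2 (h J hJ)).2 hle
  have h2 := card_filter_eq_of_card_filter_le _ _ _ h1 (weight κ v a)
  by_contra! hc
  refine (Finset.card_lt_card (?_ : S.1.filter _ ⊂ J.1.filter _)).ne h2
  rw [Finset.ssubset_iff_of_subset]
  · exact ⟨a, by simp [haJ], by simp [haS]⟩
  · intro b hb
    rw [Finset.mem_filter] at hb ⊢
    refine ⟨?_, hb.2⟩
    by_contra hbJ
    exact hc b hb.1 hbJ hb.2

theorem GenericParameters.pair_eq (hgen : GenericParameters k κ) (hk : 2 ≤ k) {a b c d : Fin n}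
    (hab : a ≠ b) (hcd : c ≠ d) (h : κ a + κ b = κ c + κ d) :
    ({a, b} : Finset (Fin n)) = {c, d} :=
  hgen 2 le_rfl hk _ _ (Finset.card_pair hab) (Finset.card_pair hcd)
    (by rw [Finset.sum_pair hab, Finset.sum_pair hcd, h])

theorem exists_mem_notMem_of_ne {S J : KSubset k n} (h : J ≠ S) : ∃ a ∈ J.1, a ∉ S.1 := by
  by_contra! hc
  exact h (Subtype.ext (Finset.eq_of_subset_of_card_le hc (by rw [S.2, J.2])))

theorem slope_eq_of_tie (hκ : StrictMono κ) {v : ℝ × ℝ} {a b : Fin n} (hab : a ≠ b)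
    (h : weight κ v a = weight κ v b) : v.1 + (κ a + κ b) * v.2 = 0 := by
  have h1 := weight_sub_weight κ v a b
  rw [h, sub_self, eq_comm, mul_eq_zero] at h1
  exact h1.resolve_left (sub_ne_zero.2 (hκ.injective.ne hab))

/-- Every element of J outside S is tied to one of S outside J, and all tied pairs have the same sum
κ_a + κ_b, fixed by the slope of `v`. By genericity there is only one such pair. -/
theorem DominatesAt.exists_swap (hκ : StrictMono κ) (hgen : GenericParameters k κ)
    {v : ℝ × ℝ} (hv : v ≠ 0) {S J : KSubset k n} (h : DominatesAt κ A v S)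
    (hJ : J ∈ matroid A) (hle : linPart κ S v ≤ linPart κ J v) (hne : J ≠ S) :
    ∃ a b, a ∉ S.1 ∧ b ∈ S.1 ∧ J.1 = insert a (S.1.erase b) ∧
      v.1 + (κ a + κ b) * v.2 = 0 := by
  obtain ⟨a, haJ, haS⟩ := exists_mem_notMem_of_ne hne
  obtain ⟨b, hbS, hbJ, hw⟩ := h.exists_tie hJ hle a haJ haS
  have hab : a ≠ b := fun he => hbJ (he ▸ haJ)
  have hs := slope_eq_of_tie hκ hab hw.symm
  have hy : v.2 ≠ 0 := by
    intro hy
    rw [hy] at hs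
    exact hv (Prod.ext (by simpa using hs) hy)
  have huniq : ∀ a' ∈ J.1, a' ∉ S.1 → a' = a := by
    intro a' haJ' haS'
    -- For k ≤ 1 genericity is void on pairs, but then J has at most one element.
    rcases Nat.lt_or_ge 1 k with hk | hk
    · obtain ⟨b', hbS', hbJ', hw'⟩ := h.exists_tie hJ hle a' haJ' haS'
      have hab' : a' ≠ b' := fun he => hbJ' (he ▸ haJ')
      have hs' := slope_eq_of_tie hκ hab' hw'.symm
      have he : κ a' + κ b' = κ a + κ b := mul_right_cancel₀ hy (by linarith)
      have hp := hgen.pair_eq hk hab' hab he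
      have : a' ∈ ({a, b} : Finset (Fin n)) := hp ▸ Finset.mem_insert_self _ _
      simp only [Finset.mem_insert, Finset.mem_singleton] at this
      exact this.resolve_right fun hb => hbJ (hb ▸ haJ')
    · exact Finset.card_le_one.1 (J.2.trans_le hk) a' haJ' a haJ
  refine ⟨a, b, haS, hbS, ?_, hs⟩
  refine Finset.eq_of_subset_of_card_le ?_ ?_
  · intro x hx
    rw [Finset.mem_insert, Finset.mem_erase]
    by_cases hxS : x ∈ S.1
    · exact Or.inr ⟨fun he => hbJ (he ▸ hx), hxS⟩
    · exact Or.inl (huniq x hx hxS)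
  · rw [Finset.card_insert_of_notMem (by simp [haS]), Finset.card_erase_of_mem hbS, S.2, J.2]
    have : 0 < J.1.card := Finset.card_pos.2 ⟨a, haJ⟩
    rw [J.2] at this
    omega

theorem sum_parameters_injective (hκ : StrictMono κ) (hgen : GenericParameters k κ)
    {S J : KSubset k n} (h : ∑ j ∈ S.1, κ j = ∑ j ∈ J.1, κ j) : S = J := by
  obtain ⟨S, hS⟩ := S
  obtain ⟨J, hJ⟩ := J
  simp only [Subtype.mk.injEq] at h ⊢
  rcases Nat.lt_or_ge 1 k with hk | hk
  · exact hgen k hk le_rfl S J hS hJ h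
  · interval_cases k
    · rw [Finset.card_eq_zero] at hS hJ
      rw [hS, hJ]
    · obtain ⟨a, rfl⟩ := Finset.card_eq_one.1 hS
      obtain ⟨b, rfl⟩ := Finset.card_eq_one.1 hJ
      rw [Finset.sum_singleton, Finset.sum_singleton] at h
      rw [hκ.injective h]

/-- The two linear forms have different x-coefficients by genericity. Equality at `v` would be
violated by moving slightly along the x-axis in the direction of their difference `p`. -/
theorem linPart_lt_of_eventually_le (hκ : StrictMono κ) (hgen : GenericParameters k κ)
    {v : ℝ × ℝ} {S J : KSubset k n} (hne : J ≠ S)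
    (h : ∀ᶠ u in 𝓝 v, linPart κ J u ≤ linPart κ S u) : linPart κ J v < linPart κ S v := by
  set p := ∑ j ∈ J.1, κ j - ∑ j ∈ S.1, κ j with hp
  have hp0 : p ≠ 0 := sub_ne_zero.2 fun he => hne (sum_parameters_injective hκ hgen he)
  have hc : Tendsto (fun e : ℝ => (v.1 + e * p, v.2)) (𝓝 0) (𝓝 v) := by
    have : Continuous (fun e : ℝ => (v.1 + e * p, v.2)) := by fun_prop
    simpa using this.tendsto 0
  obtain ⟨e, he, he0⟩ :=
    (((hc.mono_left nhdsWithin_le_nhds).eventually h).and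
      (self_mem_nhdsWithin : Ioi (0 : ℝ) ∈ 𝓝[>] 0)).exists
  rw [linPart_eq, linPart_eq] at he ⊢
  have : 0 < e * (p * p) := mul_pos he0 (mul_self_pos.2 hp0)
  have hJp : ∑ j ∈ J.1, κ j = p + ∑ j ∈ S.1, κ j := by rw [hp]; ring
  rw [hJp] at he ⊢
  linear_combination he + this

theorem linPart_lt_of_snd_eq_zero (hκ : StrictMono κ) {v : ℝ × ℝ} (hv : v.2 = 0)
    (hv1 : v.1 ≠ 0) {S J : KSubset k n} (h : DominatesAt κ A v S) (hJ : J ∈ matroid A)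
    (hne : J ≠ S) : linPart κ J v < linPart κ S v := by
  by_contra! hle
  obtain ⟨a, haJ, haS⟩ := exists_mem_notMem_of_ne hne
  obtain ⟨b, hbS, hbJ, hw⟩ := h.exists_tie hJ hle a haJ haS
  have hs := slope_eq_of_tie hκ (fun he : a = b => hbJ (he ▸ haJ)) hw.symm
  rw [hv] at hs
  exact hv1 (by simpa using hs)

/-! ### Optimality of the necklace members. -/

variable [NeZero n] {I : Fin n → KSubset k n} {σ : Equiv.Perm (Fin n)} {m : ℕ}

/-- For y ≤ 0 the weight is a concave function of κ_j, so its superlevel sets are intervals. -/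
theorem dominatesAt_of_nonpos (hκ : StrictMono κ) (hI : IsLexMinSequence (matroid A) I)
    (hN : IsNecklaceAlong I σ) (hσ : IsOneDescentDerangement σ m) {v : ℝ × ℝ} (hv : v.2 ≤ 0)
    (r : ℕ) (hr : r ≤ m)
    (h1 : ∀ i : Fin n, i.1 < r → weight κ v i ≤ weight κ v (σ i))
    (h2 : ∀ i : Fin n, r ≤ i.1 → i.1 < m → weight κ v (σ i) ≤ weight κ v i) :
    DominatesAt κ A v (I (Fin.ofNat n r)) := by
  intro J hJ c
  have := card_inter_le_of_interval hI hN hσ r hr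
    (Finset.univ.filter (fun j => c ≤ weight κ v j)) ?_ ?_ ?_ J hJ
  · simpa only [Finset.inter_filter, Finset.inter_univ] using this
  · intro a b d hab hbd ha hd
    simp only [Finset.mem_filter, Finset.mem_univ, true_and] at ha hd ⊢
    by_contra! hb
    have e1 := weight_sub_weight κ v a b
    have e2 := weight_sub_weight κ v d b
    have k1 := hκ hab
    have k2 := hκ hbd
    have f1 : v.1 + (κ a + κ b) * v.2 < 0 := by
      by_contra! hc
      nlinarith [mul_nonneg (sub_nonneg.2 k1.le) hc]
    have f2 : 0 < v.1 + (κ d + κ b) * v.2 := by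
      by_contra! hc
      nlinarith [mul_nonneg (sub_nonneg.2 k2.le) (neg_nonneg.2 hc)]
    nlinarith [mul_nonneg (sub_nonneg.2 (k1.trans k2).le) (neg_nonneg.2 hv)]
  · intro i hi hiT
    simp only [Finset.mem_filter, Finset.mem_univ, true_and] at hiT ⊢
    exact hiT.trans (h1 i hi)
  · intro i hi him hiT
    simp only [Finset.mem_filter, Finset.mem_univ, true_and] at hiT ⊢
    exact hiT.trans (h2 i hi him)

/-- For y ≥ 0 the weight is a convex function of κ_j, so its sublevel sets are intervals. -/
theorem dominatesAt_of_nonneg (hκ : StrictMono κ) (hI : IsLexMinSequence (matroid A) I)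
    (hN : IsNecklaceAlong I σ) (hσ : IsOneDescentDerangement σ m) {v : ℝ × ℝ} (hv : 0 ≤ v.2)
    (r : ℕ) (hrn : r ≤ n)
    (h1 : ∀ i : Fin n, m ≤ i.1 → i.1 < r → weight κ v i ≤ weight κ v (σ i))
    (h2 : ∀ i : Fin n, r ≤ i.1 → weight κ v (σ i) ≤ weight κ v i) :
    DominatesAt κ A v (I (Fin.ofNat n r)) := by
  intro J hJ c
  have := card_inter_le_of_interval_compl hI hN hσ r hrn
    (Finset.univ.filter (fun j => c ≤ weight κ v j)) ?_ ?_ ?_ J hJ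
  · simpa only [Finset.inter_filter, Finset.inter_univ] using this
  · intro a b d hab hbd ha hd
    simp only [Finset.mem_filter, Finset.mem_univ, true_and, not_le] at ha hd ⊢
    by_contra! hb
    have e1 := weight_sub_weight κ v a b
    have e2 := weight_sub_weight κ v d b
    have k1 := hκ hab
    have k2 := hκ hbd
    have f1 : 0 < v.1 + (κ a + κ b) * v.2 := by
      by_contra! hc
      nlinarith [mul_nonneg (sub_nonneg.2 k1.le) (neg_nonneg.2 hc)]
    have f2 : v.1 + (κ d + κ b) * v.2 < 0 := by
      by_contra! hc
      nlinarith [mul_nonneg (sub_nonneg.2 k2.le) hc]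
    nlinarith [mul_nonneg (sub_nonneg.2 (k1.trans k2).le) hv]
  · intro i hi hir hiT
    simp only [Finset.mem_filter, Finset.mem_univ, true_and] at hiT ⊢
    exact hiT.trans (h1 i hi hir)
  · intro i hi hiT
    simp only [Finset.mem_filter, Finset.mem_univ, true_and] at hiT ⊢
    exact hiT.trans (h2 i hi)

/-- The strict hypotheses persist near `v`, so `I r` is weakly optimal in a whole neighbourhood,
which forces strict optimality at `v`. -/
theorem linPart_lt_of_neg (hκ : StrictMono κ) (hgen : GenericParameters k κ)
    (hI : IsLexMinSequence (matroid A) I)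
    (hN : IsNecklaceAlong I σ) (hσ : IsOneDescentDerangement σ m) {v : ℝ × ℝ} (hv : v.2 < 0)
    (r : ℕ) (hr : r ≤ m)
    (h1 : ∀ i : Fin n, i.1 < r → weight κ v i < weight κ v (σ i))
    (h2 : ∀ i : Fin n, r ≤ i.1 → i.1 < m → weight κ v (σ i) < weight κ v i)
    {J : KSubset k n} (hJ : J ∈ matroid A) (hne : J ≠ I (Fin.ofNat n r)) :
    linPart κ J v < linPart κ (I (Fin.ofNat n r)) v := by
  refine linPart_lt_of_eventually_le hκ hgen hne ?_
  have e0 : ∀ᶠ u : ℝ × ℝ in 𝓝 v, u.2 < 0 := continuous_snd.continuousAt.eventually_lt_const hv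
  have e1 : ∀ᶠ u in 𝓝 v, ∀ i : Fin n, i.1 < r → weight κ u i < weight κ u (σ i) :=
    eventually_all.2 fun i => by
      by_cases hi : i.1 < r
      · filter_upwards [(continuous_weight κ i).continuousAt.eventually_lt
          (continuous_weight κ (σ i)).continuousAt (h1 i hi)] with u hu _ using hu
      · exact Eventually.of_forall fun u h => absurd h hi
  have e2 : ∀ᶠ u in 𝓝 v, ∀ i : Fin n, r ≤ i.1 ∧ i.1 < m → weight κ u (σ i) < weight κ u i :=
    eventually_all.2 fun i => by
      by_cases hi : r ≤ i.1 ∧ i.1 < m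
      · filter_upwards [(continuous_weight κ (σ i)).continuousAt.eventually_lt
          (continuous_weight κ i).continuousAt (h2 i hi.1 hi.2)] with u hu _ using hu
      · exact Eventually.of_forall fun u h => absurd h hi
  filter_upwards [e0, e1, e2] with u hu0 hu1 hu2
  exact (dominatesAt_of_nonpos hκ hI hN hσ hu0.le r hr (fun i hi => (hu1 i hi).le)
    (fun i hi him => (hu2 i ⟨hi, him⟩).le)).linPart_le hJ

theorem linPart_lt_of_pos (hκ : StrictMono κ) (hgen : GenericParameters k κ)
    (hI : IsLexMinSequence (matroid A) I)
    (hN : IsNecklaceAlong I σ) (hσ : IsOneDescentDerangement σ m) {v : ℝ × ℝ} (hv : 0 < v.2)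
    (r : ℕ) (hr : r ≤ n)
    (h1 : ∀ i : Fin n, m ≤ i.1 → i.1 < r → weight κ v i < weight κ v (σ i))
    (h2 : ∀ i : Fin n, r ≤ i.1 → weight κ v (σ i) < weight κ v i)
    {J : KSubset k n} (hJ : J ∈ matroid A) (hne : J ≠ I (Fin.ofNat n r)) :
    linPart κ J v < linPart κ (I (Fin.ofNat n r)) v := by
  refine linPart_lt_of_eventually_le hκ hgen hne ?_
  have e0 : ∀ᶠ u : ℝ × ℝ in 𝓝 v, 0 < u.2 := continuous_snd.continuousAt.eventually_const_lt hv
  have e1 : ∀ᶠ u in 𝓝 v, ∀ i : Fin n, m ≤ i.1 ∧ i.1 < r → weight κ u i < weight κ u (σ i) :=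
    eventually_all.2 fun i => by
      by_cases hi : m ≤ i.1 ∧ i.1 < r
      · filter_upwards [(continuous_weight κ i).continuousAt.eventually_lt
          (continuous_weight κ (σ i)).continuousAt (h1 i hi.1 hi.2)] with u hu _ using hu
      · exact Eventually.of_forall fun u h => absurd h hi
  have e2 : ∀ᶠ u in 𝓝 v, ∀ i : Fin n, r ≤ i.1 → weight κ u (σ i) < weight κ u i :=
    eventually_all.2 fun i => by
      by_cases hi : r ≤ i.1
      · filter_upwards [(continuous_weight κ (σ i)).continuousAt.eventually_lt
          (continuous_weight κ i).continuousAt (h2 i hi)] with u hu _ using hu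
      · exact Eventually.of_forall fun u h => absurd h hi
  filter_upwards [e0, e1, e2] with u hu0 hu1 hu2
  exact (dominatesAt_of_nonneg hκ hI hN hσ hu0.le r hr (fun i hi hir => (hu1 i ⟨hi, hir⟩).le)
    (fun i hi => (hu2 i hi).le)).linPart_le hJ

theorem dominatesAt_zero_of_fst_neg (hκ : StrictMono κ) (hI : IsLexMinSequence (matroid A) I)
    (hN : IsNecklaceAlong I σ) (hσ : IsOneDescentDerangement σ m) {v : ℝ × ℝ} (hv : v.2 = 0)
    (hv1 : v.1 < 0) : DominatesAt κ A v (I 0) := by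
  have := dominatesAt_of_nonpos (r := 0) hκ hI hN hσ hv.le (Nat.zero_le _) (by simp) (by
    intro i _ hi
    have h1 := weight_sub_weight κ v i (σ i)
    have h2 := hκ (hσ.lt_apply i hi)
    rw [hv] at h1
    nlinarith)
  simpa using this

/-- Another optimal basis would differ from `I (i + 1)` by a swap of a tied pair. That pair must be
{i, σ i}, and the swap undoes the necklace step, giving `I i`. -/
theorem linPart_lt_succ_of_critical (hκ : StrictMono κ) (hgen : GenericParameters k κ)
    (hN : IsNecklaceAlong I σ) {v : ℝ × ℝ} (hv : v.2 ≠ 0) (i : Fin n) (hσi : i ≠ σ i)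
    (hi : v.1 + (κ i + κ (σ i)) * v.2 = 0) (hd : DominatesAt κ A v (I (i + 1)))
    {J : KSubset k n} (hJ : J ∈ matroid A) (hJ0 : J ≠ I i) (hJ1 : J ≠ I (i + 1)) :
    linPart κ J v < linPart κ (I (i + 1)) v := by
  by_contra! hle
  obtain ⟨a, b, ha, hb, he, hs⟩ := hd.exists_swap hκ hgen
    (fun h => hv (by rw [h]; rfl)) hJ hle hJ1
  obtain ⟨hiI, hσI, hstep⟩ := hN i
  have hab : κ a + κ b = κ i + κ (σ i) := mul_right_cancel₀ hv (by linarith)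
  have hσmem : σ i ∈ (I (i + 1)).1 := by rw [hstep]; simp
  have hne : a ≠ b := fun h => ha (h ▸ hb)
  have hbσ : b = σ i := by
    rcases Nat.lt_or_ge 1 k with hk | hk
    · have hp := hgen.pair_eq hk hne hσi hab
      have : σ i ∈ ({a, b} : Finset (Fin n)) := hp ▸ (by simp)
      simp only [Finset.mem_insert, Finset.mem_singleton] at this
      exact (this.resolve_left fun h => ha (h ▸ hσmem)).symm
    · exact Finset.card_le_one.1 ((I (i + 1)).2.trans_le hk) b hb _ hσmem
  have hai : a = i := hκ.injective (by rw [hbσ] at hab; linarith)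
  refine hJ0 (Subtype.ext ?_)
  rw [he, hstep, hai, hbσ, Finset.erase_insert (by simp [hσI]), Finset.insert_erase hiI]

/-- A basis that is not in the necklace is not optimal in any direction. -/
theorem exists_linPart_lt (hκ : StrictMono κ) (hgen : GenericParameters k κ)
    (hI : IsLexMinSequence (matroid A) I)
    (hN : IsNecklaceAlong I σ) (hσ : IsOneDescentDerangement σ m) {v : ℝ × ℝ} (hv : v ≠ 0)
    {J : KSubset k n} (hJ : J ∈ matroid A) (hne : ∀ r, J ≠ I r) :
    ∃ r, linPart κ J v < linPart κ (I r) v := by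
  have hmn := hσ.lt_card
  set q : ℕ → ℝ := fun i => v.1 + (κ (Fin.ofNat n i) + κ (σ (Fin.ofNat n i))) * v.2 with hq
  have hqi : ∀ i : Fin n, v.1 + (κ i + κ (σ i)) * v.2 = q i.1 := fun i => by simp [hq]
  have hdiff : ∀ i : Fin n, weight κ v i - weight κ v (σ i) = (κ i - κ (σ i)) * q i.1 :=
    fun i => by rw [weight_sub_weight, hqi]
  have hlow : ∀ i : Fin n, i.1 < m → κ i - κ (σ i) < 0 := fun i hi =>
    sub_neg.2 (hκ (hσ.lt_apply i hi))
  have hup : ∀ i : Fin n, m ≤ i.1 → 0 < κ i - κ (σ i) := fun i hi =>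
    sub_pos.2 (hκ (hσ.apply_lt i hi))
  rcases lt_trichotomy v.2 0 with hy | hy | hy
  · have hqm : ∀ i j : Fin n, j.1 < m → i < j → q j.1 < q i.1 := by
      intro i j hj hij
      rw [← hqi, ← hqi]
      have h1 := hκ hij
      have h2 := hκ (hσ.mono_left i j hj hij)
      nlinarith
    -- Here `q` decreases on the first block, so `r` counts the first-block exchanges already
    -- favourable at `v`. If `q` vanishes before `r`, it does so only at `r - 1`.
    have hex : ∃ r, r = m ∨ q r < 0 := ⟨m, Or.inl rfl⟩
    classical
    set r := Nat.find hex with hr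
    have hrm : r ≤ m := Nat.find_min' hex (Or.inl rfl)
    have hbefore : ∀ i, i < r → 0 ≤ q i := fun i hi => by
      have := Nat.find_min hex hi
      push Not at this
      exact this.2
    have hafter : ∀ i : Fin n, r ≤ i.1 → i.1 < m → q i.1 < 0 := by
      intro i hri him
      have hqr : q r < 0 := (Nat.find_spec hex).resolve_left (by omega)
      rcases eq_or_lt_of_le hri with h | h
      · rwa [← h]
      · exact (hqm ⟨r, by omega⟩ i him h).trans hqr
    by_cases hcrit : ∃ i : Fin n, i.1 < r ∧ q i.1 = 0
    · obtain ⟨i, hir, hi0⟩ := hcrit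
      have hri : r = i.1 + 1 := by
        by_contra hne'
        have h1 := hqm i ⟨i.1 + 1, by omega⟩ (by simp; omega) (by rw [Fin.lt_def]; simp)
        have h2 := hbefore (i.1 + 1) (by omega)
        simp only at h1
        linarith
      have hd := dominatesAt_of_nonpos hκ hI hN hσ hy.le r hrm
        (fun j hj => by
          have := hdiff j
          nlinarith [hlow j (by omega), hbefore _ hj])
        (fun j hj hjm => by
          have := hdiff j
          nlinarith [hlow j (by omega), hafter _ hj hjm])
      have hofn : Fin.ofNat n r = i + 1 := by rw [hri, fin_ofNat_succ]; simp
      rw [hofn] at hd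
      exact ⟨i + 1, linPart_lt_succ_of_critical hκ hgen hN hy.ne i
        (hσ.lt_apply i (by omega)).ne (by rw [hqi, hi0]) hd hJ (hne _) (hne _)⟩
    · push Not at hcrit
      refine ⟨_, linPart_lt_of_neg hκ hgen hI hN hσ hy r hrm (fun j hj => ?_)
        (fun j hj hjm => ?_) hJ (hne _)⟩
      · have := hdiff j
        have hpos : 0 < q j.1 := lt_of_le_of_ne (hbefore _ hj) (hcrit j hj).symm
        nlinarith [hlow j (by omega)]
      · have := hdiff j
        nlinarith [hlow j (by omega), hafter _ hj hjm]
  · have hx : v.1 ≠ 0 := fun hx => hv (Prod.ext hx hy)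
    have hq1 : ∀ i, q i = v.1 := fun i => by simp [hq, hy]
    rcases lt_or_gt_of_ne hx with hx' | hx'
    · exact ⟨0, linPart_lt_of_snd_eq_zero hκ hy hx
        (dominatesAt_zero_of_fst_neg hκ hI hN hσ hy hx') hJ (hne _)⟩
    -- On the positive x-axis all exchanges of the first block raise the weight, so `I m` is
    -- optimal.
    · refine ⟨_, linPart_lt_of_snd_eq_zero hκ hy hx
        (dominatesAt_of_nonpos hκ hI hN hσ hy.le m le_rfl (fun i hi => ?_)
          (fun i h1 h2 => absurd h1 (by omega))) hJ (hne _)⟩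
      have := hdiff i
      rw [hq1] at this
      nlinarith [hlow i hi]
  · have hqm : ∀ i j : Fin n, m ≤ i.1 → i < j → q i.1 < q j.1 := by
      intro i j hj hij
      rw [← hqi, ← hqi]
      have h1 := hκ hij
      have h2 := hκ (hσ.mono_right i j hj hij)
      nlinarith
    -- The default `n` means that all exchanges have been made; `Fin.ofNat n n` is 0, so the
    -- necklace is back at `I 0`.
    have hex : ∃ r, r = n ∨ (m ≤ r ∧ 0 < q r) := ⟨n, Or.inl rfl⟩
    classical
    set r := Nat.find hex with hr
    have hrn : r ≤ n := Nat.find_min' hex (Or.inl rfl)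
    have hbefore : ∀ i, m ≤ i → i < r → q i ≤ 0 := fun i him hi => by
      have := Nat.find_min hex hi
      push Not at this
      exact this.2 him
    have hmr : m ≤ r := by
      rcases Nat.find_spec hex with h | h
      · rw [← hr] at h; omega
      · exact h.1
    have hafter : ∀ i : Fin n, r ≤ i.1 → 0 < q i.1 := by
      intro i hri
      have hqr : 0 < q r := ((Nat.find_spec hex).resolve_left (by omega)).2
      rcases eq_or_lt_of_le hri with h | h
      · rwa [← h]
      · exact hqr.trans (hqm ⟨r, by omega⟩ i hmr h)
    by_cases hcrit : ∃ i : Fin n, m ≤ i.1 ∧ i.1 < r ∧ q i.1 = 0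
    · obtain ⟨i, him, hir, hi0⟩ := hcrit
      have hri : r = i.1 + 1 := by
        by_contra hne'
        have h1 := hqm i ⟨i.1 + 1, by omega⟩ him (by rw [Fin.lt_def]; simp)
        have h2 := hbefore (i.1 + 1) (by omega) (by omega)
        simp only at h1
        linarith
      have hd := dominatesAt_of_nonneg hκ hI hN hσ hy.le r hrn
        (fun j hjm hj => by
          have := hdiff j
          nlinarith [hup j hjm, hbefore _ hjm hj])
        (fun j hj => by
          have := hdiff j
          nlinarith [hup j (by omega), hafter _ hj])
      have hofn : Fin.ofNat n r = i + 1 := by rw [hri, fin_ofNat_succ]; simp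
      rw [hofn] at hd
      exact ⟨i + 1, linPart_lt_succ_of_critical hκ hgen hN hy.ne' i
        (hσ.apply_lt i him).ne' (by rw [hqi, hi0]) hd hJ (hne _) (hne _)⟩
    · push Not at hcrit
      refine ⟨_, linPart_lt_of_pos hκ hgen hI hN hσ hy r hrn (fun j hjm hj => ?_)
        (fun j hj => ?_) hJ (hne _)⟩
      · have := hdiff j
        have hneg : q j.1 < 0 := lt_of_le_of_ne (hbefore _ hjm hj) (hcrit j hjm hj)
        nlinarith [hup j hjm]
      · have := hdiff j
        nlinarith [hup j (by omega), hafter _ hj]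

end

section

/-! ### Critical angles -/

/-- The unit vector at angle `θ`. -/
noncomputable def direction (θ : ℝ) : ℝ × ℝ := (Real.cos θ, Real.sin θ)

/-- At the angle `φ i` the weights of `i` and `σ i` coincide; the angles are listed
counterclockwise, those of the first block in the lower half plane and those of the second block
in the upper half plane. -/
structure IsCriticalAngles {n : ℕ} (κ : Fin n → ℝ) (σ : Equiv.Perm (Fin n)) (m : ℕ)
    (φ : Fin n → ℝ) : Prop where
  strictMono : StrictMono φ
  pi_lt : ∀ i, Real.pi < φ i
  lt_three_pi : ∀ i, φ i < 3 * Real.pi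
  lt_two_pi : ∀ i : Fin n, i.1 < m → φ i < 2 * Real.pi
  two_pi_lt : ∀ i : Fin n, m ≤ i.1 → 2 * Real.pi < φ i
  weight_sub : ∀ i, ∃ C > 0, ∀ θ, weight κ (direction θ) i - weight κ (direction θ) (σ i) =
    C * Real.sin (φ i - θ)

/-- With α = arctan(κ_i + κ_{σ i}), the weight difference is a multiple of cos(θ - α). The sign of
κ_i - κ_{σ i} differs between the blocks; taking the zero π further on for the second block makes
the factor C positive for both. -/
theorem exists_isCriticalAngles {n : ℕ} {κ : Fin n → ℝ} (hκ : StrictMono κ)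
    {σ : Equiv.Perm (Fin n)} {m : ℕ} (hσ : IsOneDescentDerangement σ m) :
    ∃ φ, IsCriticalAngles κ σ m φ := by
  set α : Fin n → ℝ := fun i => Real.arctan (κ i + κ (σ i)) with hα
  have hlo : ∀ i, -(Real.pi / 2) < α i := fun i => Real.neg_pi_div_two_lt_arctan _
  have hhi : ∀ i, α i < Real.pi / 2 := fun i => Real.arctan_lt_pi_div_two _
  have hcos : ∀ i, 0 < Real.cos (α i) := fun i => Real.cos_arctan_pos _
  have hsin : ∀ i, Real.sin (α i) = (κ i + κ (σ i)) * Real.cos (α i) := by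
    intro i
    rw [← Real.tan_mul_cos (hcos i).ne', hα, Real.tan_arctan]
  have hpi := Real.pi_pos
  have hw : ∀ i θ, weight κ (direction θ) i - weight κ (direction θ) (σ i) =
      (κ i - κ (σ i)) / Real.cos (α i) * Real.cos (θ - α i) := by
    intro i θ
    rw [weight_sub_weight, Real.cos_sub, hsin]
    have := (hcos i).ne'
    simp only [direction]
    field_simp
  refine ⟨fun i => (if i.1 < m then Real.pi else 2 * Real.pi) + (Real.pi / 2 + α i),
    ?_, ?_, ?_, ?_, ?_, ?_⟩
  · intro i j hij
    have hij' : i.1 < j.1 := hij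
    have hi := hhi i
    have hj := hlo j
    by_cases h1 : j.1 < m
    · simp only [if_pos h1, if_pos (hij'.trans h1)]
      have : α i < α j :=
        Real.arctan_strictMono (add_lt_add (hκ hij) (hκ (hσ.mono_left i j h1 hij)))
      linarith
    · by_cases h2 : i.1 < m
      · simp only [if_neg h1, if_pos h2]
        linarith
      · simp only [if_neg h1, if_neg h2]
        have : α i < α j :=
          Real.arctan_strictMono
            (add_lt_add (hκ hij) (hκ (hσ.mono_right i j (not_lt.1 h2) hij)))
        linarith
  · intro i
    have := hlo i
    split_ifs <;> linarith
  · intro i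
    have := hhi i
    split_ifs <;> linarith
  · intro i h
    have := hhi i
    simp only [if_pos h]
    linarith
  · intro i h
    have := hlo i
    simp only [if_neg (not_lt.2 h)]
    linarith
  · intro i
    by_cases h : i.1 < m
    · refine ⟨(κ (σ i) - κ i) / Real.cos (α i),
        div_pos (sub_pos.2 (hκ (hσ.lt_apply i h))) (hcos i), fun θ => ?_⟩
      rw [hw]
      simp only [if_pos h]
      have : Real.pi + (Real.pi / 2 + α i) - θ = Real.pi / 2 - (θ - α i) + Real.pi := by ring
      rw [this, Real.sin_add_pi, Real.sin_pi_div_two_sub]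
      ring
    · refine ⟨(κ i - κ (σ i)) / Real.cos (α i),
        div_pos (sub_pos.2 (hκ (hσ.apply_lt i (not_lt.1 h)))) (hcos i), fun θ => ?_⟩
      rw [hw]
      simp only [if_neg h]
      have : 2 * Real.pi + (Real.pi / 2 + α i) - θ =
        Real.pi / 2 - (θ - α i) + 2 * Real.pi := by ring
      rw [this, Real.sin_add_two_pi, Real.sin_pi_div_two_sub]

theorem direction_ne_zero (θ : ℝ) : direction θ ≠ 0 := by
  intro h
  have h1 : Real.cos θ = 0 := congrArg Prod.fst h
  have h2 : Real.sin θ = 0 := congrArg Prod.snd h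
  have := Real.sin_sq_add_cos_sq θ
  rw [h1, h2] at this
  norm_num at this

namespace IsCriticalAngles

variable {n : ℕ} {κ : Fin n → ℝ} {σ : Equiv.Perm (Fin n)} {m : ℕ} {φ : Fin n → ℝ}

theorem weight_lt (h : IsCriticalAngles κ σ m φ) {i : Fin n} {θ : ℝ} (h1 : φ i < θ)
    (h2 : θ < φ i + Real.pi) : weight κ (direction θ) i < weight κ (direction θ) (σ i) := by
  obtain ⟨C, hC, hw⟩ := h.weight_sub i
  have := Real.sin_neg_of_neg_of_neg_pi_lt (x := φ i - θ) (by linarith) (by linarith)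
  have h3 := hw θ
  nlinarith

theorem lt_weight (h : IsCriticalAngles κ σ m φ) {i : Fin n} {θ : ℝ} (h1 : θ < φ i)
    (h2 : φ i < θ + Real.pi) : weight κ (direction θ) (σ i) < weight κ (direction θ) i := by
  obtain ⟨C, hC, hw⟩ := h.weight_sub i
  have := Real.sin_pos_of_pos_of_lt_pi (x := φ i - θ) (by linarith) (by linarith)
  have h3 := hw θ
  nlinarith

theorem sin_nonneg (h : IsCriticalAngles κ σ m φ) {i : Fin n} {θ : ℝ}
    (hle : weight κ (direction θ) (σ i) ≤ weight κ (direction θ) i) :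
    0 ≤ Real.sin (φ i - θ) := by
  obtain ⟨C, hC, hw⟩ := h.weight_sub i
  refine nonneg_of_mul_nonneg_right (a := C) ?_ hC
  rw [← hw]
  linarith

theorem sin_nonpos (h : IsCriticalAngles κ σ m φ) {i : Fin n} {θ : ℝ}
    (hle : weight κ (direction θ) i ≤ weight κ (direction θ) (σ i)) :
    Real.sin (φ i - θ) ≤ 0 := by
  obtain ⟨C, hC, hw⟩ := h.weight_sub i
  by_contra! hc
  have := mul_pos hC hc
  rw [← hw] at this
  linarith

end IsCriticalAngles

theorem IsNecklaceAlong.linPart_succ {k n : ℕ} [NeZero n] {I : Fin n → KSubset k n}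
    {σ : Equiv.Perm (Fin n)} (hN : IsNecklaceAlong I σ) (κ : Fin n → ℝ) (v : ℝ × ℝ) (i : Fin n) :
    linPart κ (I (i + 1)) v + weight κ v i = linPart κ (I i) v + weight κ v (σ i) := by
  obtain ⟨h1, h2, h3⟩ := hN i
  unfold linPart
  rw [h3, Finset.sum_insert (by simp [h2]), ← Finset.add_sum_erase _ _ h1]
  ring

variable {k n : ℕ} [NeZero n] {A : Matrix (Fin k) (Fin n) ℝ} {κ : Fin n → ℝ}
  {I : Fin n → KSubset k n} {σ : Equiv.Perm (Fin n)} {m : ℕ} {φ : Fin n → ℝ}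

/-- If `I r` is optimal in the direction `θ`, then `θ` lies between the critical angles at
which `I r` arises and disappears. -/
theorem angle_mem_Icc_of_optimal (hI : IsLexMinSequence (matroid A) I)
    (hN : IsNecklaceAlong I σ) (hφ : IsCriticalAngles κ σ m φ) {θ : ℝ} (h1 : Real.pi ≤ θ)
    (h2 : θ < 3 * Real.pi) (i r : Fin n) (hi : i.1 + 1 = r.1)
    (hmax : ∀ J ∈ matroid A, linPart κ J (direction θ) ≤ linPart κ (I r) (direction θ)) :
    φ i ≤ θ ∧ θ ≤ φ r := by
  have hir : i + 1 = r := by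
    apply Fin.ext
    rw [Fin.val_add_one_of_lt' (by omega), hi]
  have e1 := hN.linPart_succ κ (direction θ) i
  have e2 := hN.linPart_succ κ (direction θ) r
  rw [hir] at e1
  have s1 := hφ.sin_nonpos (i := i) (θ := θ) (by linarith [hmax _ (hI i).1])
  have s2 := hφ.sin_nonneg (i := r) (θ := θ) (by linarith [hmax _ (hI (r + 1)).1])
  have hlt : φ i < φ r := hφ.strictMono (Fin.lt_def.2 (by omega))
  have b1 := hφ.pi_lt i
  have b2 := hφ.lt_three_pi r
  constructor
  -- The sign for `i` puts φ i - θ at π or more, so φ r - θ lies strictly between π and 2π, where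
  -- the sine is negative. The other inequality is symmetric.
  · by_contra! hc
    have c1 : Real.pi ≤ φ i - θ := by
      by_contra! hc'
      exact absurd s1 (not_le.2 (Real.sin_pos_of_pos_of_lt_pi (by linarith) hc'))
    have := Real.sin_neg_of_neg_of_neg_pi_lt (x := φ r - θ - 2 * Real.pi) (by linarith)
      (by linarith)
    rw [Real.sin_sub_two_pi] at this
    linarith
  · by_contra! hc
    have c1 : φ r - θ ≤ -Real.pi := by
      by_contra! hc'
      exact absurd s2 (not_le.2 (Real.sin_neg_of_neg_of_neg_pi_lt (by linarith) hc'))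
    have := Real.sin_pos_of_pos_of_lt_pi (x := φ i - θ + 2 * Real.pi) (by linarith)
      (by linarith)
    rw [Real.sin_add_two_pi] at this
    linarith

/-- In each sector between consecutive critical angles there is a direction in which the
corresponding member of the necklace is the only optimal basis. -/
theorem exists_optimal_angles (hκ : StrictMono κ) (hgen : GenericParameters k κ)
    (hI : IsLexMinSequence (matroid A) I)
    (hN : IsNecklaceAlong I σ) (hσ : IsOneDescentDerangement σ m)
    (hφ : IsCriticalAngles κ σ m φ) :
    ∃ θ : Fin n → ℝ, StrictMono θ ∧ θ 0 = Real.pi ∧ (∀ r, θ r < φ r) ∧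
      ∀ r, ∀ J ∈ matroid A, J ≠ I r →
        linPart κ J (direction (θ r)) < linPart κ (I r) (direction (θ r)) := by
  have hpi := Real.pi_pos
  have hex : ∀ r : Fin n, ∃ t, t < φ r ∧ (r = 0 → t = Real.pi) ∧ (∀ i, i < r → φ i < t) ∧
      (r.1 ≤ m → t < 2 * Real.pi) ∧ (m < r.1 → 2 * Real.pi < t) := by
    intro r
    rcases eq_or_ne r 0 with rfl | hr
    · exact ⟨Real.pi, hφ.pi_lt 0, fun _ => rfl, fun i hi => absurd hi (Fin.not_lt_zero i),
        fun _ => by linarith, fun h => absurd h (by simp)⟩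
    · have hr0 : 0 < r.1 := Nat.pos_of_ne_zero fun h => hr (Fin.ext (by simpa using h))
      set p : Fin n := ⟨r.1 - 1, by omega⟩ with hp
      have hpr : φ p < φ r := hφ.strictMono (Fin.lt_def.2 (Nat.sub_lt hr0 one_pos))
      have hpi' : ∀ i, i < r → φ i ≤ φ p := fun i hi => hφ.strictMono.monotone
        (Fin.le_def.2 (by simp only [hp]; rw [Fin.lt_def] at hi; omega))
      -- The sector of `I m` may reach past 2π; its angle is taken below 2π so that the lower half
      -- plane criterion covers all 0 < r ≤ m.
      rcases le_or_gt r.1 m with hrm | hrm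
      · have h1 := hφ.lt_two_pi p (by simp only [hp]; omega)
        obtain ⟨t, ht1, ht2⟩ := exists_between (lt_min hpr h1)
        exact ⟨t, ht2.trans_le (min_le_left _ _), fun h => absurd h hr,
          fun i hi => (hpi' i hi).trans_lt ht1, fun _ => ht2.trans_le (min_le_right _ _),
          fun h => absurd h (by omega)⟩
      · have h1 := hφ.two_pi_lt p (by simp only [hp]; omega)
        obtain ⟨t, ht1, ht2⟩ := exists_between hpr
        exact ⟨t, ht2, fun h => absurd h hr, fun i hi => (hpi' i hi).trans_lt ht1,
          fun h => absurd h (by omega), fun _ => h1.trans ht1⟩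
  choose θ h1 h2 h3 h4 h5 using hex
  refine ⟨θ, fun i j hij => (h1 i).trans (h3 j i hij), h2 0 rfl, h1, ?_⟩
  intro r J hJ hne
  rcases eq_or_ne r 0 with rfl | hr
  · rw [h2 0 rfl]
    have hs : (direction Real.pi).2 = 0 := Real.sin_pi
    have hc : (direction Real.pi).1 = -1 := Real.cos_pi
    exact linPart_lt_of_snd_eq_zero hκ hs (by rw [hc]; norm_num)
      (dominatesAt_zero_of_fst_neg hκ hI hN hσ hs (by rw [hc]; norm_num)) hJ hne
  · have hr0 : 0 < r.1 := Nat.pos_of_ne_zero fun h => hr (Fin.ext (by simpa using h))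
    have hlow : Real.pi < θ r := (hφ.pi_lt 0).trans
      (h3 r 0 (Fin.lt_def.2 (by simpa using hr0)))
    have hofn : I (Fin.ofNat n r.1) = I r := by simp
    have hup := (h1 r).trans (hφ.lt_three_pi r)
    rw [← hofn] at hne ⊢
    rcases le_or_gt r.1 m with hrm | hrm
    · have hlt := h4 r hrm
      refine linPart_lt_of_neg hκ hgen hI hN hσ ?_ r.1 hrm (fun i hi => ?_) (fun i hi him => ?_)
        hJ hne
      · have := Real.sin_neg_of_neg_of_neg_pi_lt (x := θ r - 2 * Real.pi) (by linarith)
          (by linarith)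
        rwa [Real.sin_sub_two_pi] at this
      · have := hφ.pi_lt i
        exact hφ.weight_lt (h3 r i hi) (by linarith)
      · have := hφ.lt_two_pi i him
        exact hφ.lt_weight ((h1 r).trans_le (hφ.strictMono.monotone hi)) (by linarith)
    · have hlt := h5 r hrm
      refine linPart_lt_of_pos hκ hgen hI hN hσ ?_ r.1 r.2.le (fun i him hi => ?_)
        (fun i hi => ?_) hJ hne
      · have := Real.sin_pos_of_pos_of_lt_pi (x := θ r - 2 * Real.pi) (by linarith)
          (by linarith)
        rwa [Real.sin_sub_two_pi] at this
      · have := hφ.two_pi_lt i him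
        exact hφ.weight_lt (h3 r i hi) (by linarith)
      · have := hφ.lt_three_pi i
        exact hφ.lt_weight ((h1 r).trans_le (hφ.strictMono.monotone hi)) (by linarith)

/-- Distinct sectors are read in counterclockwise order. -/
theorem eq_id_of_optimal (hI : IsLexMinSequence (matroid A) I)
    (hN : IsNecklaceAlong I σ) (hφ : IsCriticalAngles κ σ m φ) {θ : Fin n → ℝ}
    (hθ : StrictMono θ) (hθ0 : θ 0 = Real.pi) (hθ3 : ∀ r, θ r < 3 * Real.pi)
    (τ : Fin n → Fin n) (hτ : Function.Injective τ) (hτ0 : τ 0 = 0)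
    (hmax : ∀ r, ∀ J ∈ matroid A,
      linPart κ J (direction (θ r)) ≤ linPart κ (I (τ r)) (direction (θ r))) :
    τ = id := by
  have hpos : ∀ r, r ≠ 0 → 0 < (τ r).1 := fun r hr => Nat.pos_of_ne_zero fun h =>
    hr (hτ (by rw [hτ0]; exact Fin.ext (by simpa using h)))
  have hge : ∀ r, Real.pi ≤ θ r := fun r => hθ0 ▸ hθ.monotone (Fin.zero_le r)
  have hmono : StrictMono τ := by
    intro r s hrs
    have hs : s ≠ 0 := fun h => Fin.not_lt_zero r (h ▸ hrs)
    rcases eq_or_ne r 0 with rfl | hr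
    · rw [hτ0, Fin.lt_def]
      simpa using hpos s hs
    · have pr := hpos r hr
      have ps := hpos s hs
      -- An inversion would give θ s ≤ φ (τ s) ≤ φ (τ r - 1) ≤ θ r.
      by_contra hle
      have hlt : τ s < τ r := lt_of_le_of_ne (not_lt.1 hle) fun h => hrs.ne' (hτ h)
      have a1 := (angle_mem_Icc_of_optimal hI hN hφ (hge r) (hθ3 r) ⟨(τ r).1 - 1, by omega⟩
        (τ r) (by simp only; omega) (hmax r)).1
      have a2 := (angle_mem_Icc_of_optimal hI hN hφ (hge s) (hθ3 s) ⟨(τ s).1 - 1, by omega⟩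
        (τ s) (by simp only; omega) (hmax s)).2
      have a3 : φ (τ s) ≤ φ ⟨(τ r).1 - 1, by omega⟩ := hφ.strictMono.monotone
        (Fin.le_def.2 (by simp only; rw [Fin.lt_def] at hlt; omega))
      have := hθ hrs
      linarith
  funext r
  exact le_antisymm hmono.apply_le hmono.le_apply

/-- If I r = I s with r < s, then I s is optimal at θ r, so φ (s - 1) ≤ θ r < φ r ≤ φ (s - 1). -/
theorem necklace_injective (hI : IsLexMinSequence (matroid A) I)
    (hN : IsNecklaceAlong I σ) (hφ : IsCriticalAngles κ σ m φ) {θ : Fin n → ℝ}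
    (hθ : StrictMono θ) (hθ0 : θ 0 = Real.pi) (hθφ : ∀ r, θ r < φ r)
    (hmax : ∀ r, ∀ J ∈ matroid A, J ≠ I r →
      linPart κ J (direction (θ r)) < linPart κ (I r) (direction (θ r))) :
    Function.Injective I := by
  have hge : ∀ r, Real.pi ≤ θ r := fun r => hθ0 ▸ hθ.monotone (Fin.zero_le r)
  refine Function.Injective.of_lt_imp_ne fun r s hrs he => ?_
  have hs : 0 < s.1 := by rw [Fin.lt_def] at hrs; omega
  have h1 := (angle_mem_Icc_of_optimal hI hN hφ (hge r) ((hθφ r).trans (hφ.lt_three_pi r))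
    ⟨s.1 - 1, by omega⟩ s (by simp only; omega) (fun J hJ => by
      rw [← he]
      rcases eq_or_ne J (I r) with rfl | hne
      · exact le_rfl
      · exact (hmax r J hJ hne).le)).1
  have h2 : φ r ≤ φ ⟨s.1 - 1, by omega⟩ := hφ.strictMono.monotone
    (Fin.le_def.2 (by simp only; rw [Fin.lt_def] at hrs; omega))
  linarith [hθφ r]

end

section

/-! ### Regions of the contour plot -/

/-- The points at which the phase of `J` is larger than all other phases. -/
def phaseRegion {k n : ℕ} (κ : Fin n → ℝ) (A : Matrix (Fin k) (Fin n) ℝ) (t : ℝ)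
    (J : KSubset k n) : Set (ℝ × ℝ) :=
  {p | ∀ I ∈ matroid A, I ≠ J → phase κ A I p.1 p.2 t < phase κ A J p.1 p.2 t}

/-- The value of the phase of `J` at the origin. -/
noncomputable def phaseConst {k n : ℕ} (κ : Fin n → ℝ) (A : Matrix (Fin k) (Fin n) ℝ) (t : ℝ)
    (J : KSubset k n) : ℝ :=
  Real.log (minor A J * vdm κ J) + ∑ j ∈ J.1, κ j ^ 3 * t

variable {k n : ℕ} {A : Matrix (Fin k) (Fin n) ℝ} {κ : Fin n → ℝ} {t : ℝ}

theorem phase_eq (J : KSubset k n) (p : ℝ × ℝ) :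
    phase κ A J p.1 p.2 t = phaseConst κ A t J + linPart κ J p := by
  simp only [phase, phaseConst, linPart, weight, Finset.sum_add_distrib]
  ring

theorem linPart_smul (J : KSubset k n) (s : ℝ) (v : ℝ × ℝ) :
    linPart κ J (s • v) = s * linPart κ J v := by
  rw [linPart_eq, linPart_eq]
  simp only [Prod.smul_fst, Prod.smul_snd, smul_eq_mul]
  ring

theorem continuous_linPart (J : KSubset k n) : Continuous (linPart κ J) := by
  unfold linPart
  exact continuous_finsetSum _ fun j _ => continuous_weight κ j

theorem isOpen_phaseRegion (J : KSubset k n) : IsOpen (phaseRegion κ A t J) := by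
  have : phaseRegion κ A t J = ⋂ I : {I // I ∈ matroid A ∧ I ≠ J},
      {p | phaseConst κ A t I.1 + linPart κ I.1 p < phaseConst κ A t J + linPart κ J p} := by
    ext p
    simp [phaseRegion, phase_eq]
  rw [this]
  exact isOpen_iInter_of_finite fun I => isOpen_lt
    (continuous_const.add (continuous_linPart _)) (continuous_const.add (continuous_linPart _))

theorem convex_phaseRegion (J : KSubset k n) : Convex ℝ (phaseRegion κ A t J) := by
  intro p hp q hq a b ha hb hab I hI hne
  have h1 := hp I hI hne
  have h2 := hq I hI hne
  rw [phase_eq, phase_eq, linPart_eq, linPart_eq] at h1 h2 ⊢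
  simp only [Prod.fst_add, Prod.smul_fst, smul_eq_mul, Prod.snd_add, Prod.smul_snd]
  obtain rfl : b = 1 - a := by linarith
  rcases eq_or_lt_of_le ha with rfl | ha
  · nlinarith
  · nlinarith [mul_lt_mul_of_pos_left h1 ha, mul_le_mul_of_nonneg_left h2.le hb]

theorem phaseRegion_eq_of_mem {I J : KSubset k n} (hI : I ∈ matroid A) (hJ : J ∈ matroid A)
    {p : ℝ × ℝ} (h1 : p ∈ phaseRegion κ A t I) (h2 : p ∈ phaseRegion κ A t J) : I = J := by
  by_contra hne
  exact lt_asymm (h1 J hJ (Ne.symm hne)) (h2 I hI hne)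

theorem phase_le_maxPhase {J : KSubset k n} (hJ : J ∈ matroid A) (p : ℝ × ℝ) :
    phase κ A J p.1 p.2 t ≤ maxPhase κ A p.1 p.2 t :=
  le_ciSup (f := fun J : matroid A => phase κ A J.1 p.1 p.2 t) (Set.finite_range _).bddAbove
    ⟨J, hJ⟩

theorem maxPhase_eq {J : KSubset k n} (hJ : J ∈ matroid A) {p : ℝ × ℝ}
    (h : ∀ I ∈ matroid A, phase κ A I p.1 p.2 t ≤ phase κ A J p.1 p.2 t) :
    maxPhase κ A p.1 p.2 t = phase κ A J p.1 p.2 t := by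
  have : Nonempty (matroid A) := ⟨⟨J, hJ⟩⟩
  exact le_antisymm (ciSup_le fun I => h I.1 I.2) (phase_le_maxPhase hJ p)

theorem phaseRegion_subset_compl {J : KSubset k n} (hJ : J ∈ matroid A) :
    phaseRegion κ A t J ⊆ (contourPlot κ A t)ᶜ := by
  intro p hp
  rw [contourPlot, mem_compl_iff, mem_ofPred_eq, not_not]
  refine ⟨∑ j ∈ J.1, κ j, ∑ j ∈ J.1, κ j ^ 2, phaseConst κ A t J, ?_⟩
  filter_upwards [(isOpen_phaseRegion J).mem_nhds hp] with q hq
  rw [maxPhase_eq hJ, phase_eq, linPart_eq]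
  · ring
  · intro I hI
    rcases eq_or_ne I J with rfl | hne
    · exact le_rfl
    · exact (hq I hI hne).le

theorem coeff_eq_of_eventually_le {P Q c a b d : ℝ} {p : ℝ × ℝ}
    (h : ∀ᶠ q : ℝ × ℝ in 𝓝 p, P * q.1 + Q * q.2 + c ≤ a * q.1 + b * q.2 + d)
    (he : P * p.1 + Q * p.2 + c = a * p.1 + b * p.2 + d) : P = a := by
  have hc : Tendsto (fun e : ℝ => (p.1 + e, p.2)) (𝓝 0) (𝓝 p) := by
    have : Continuous (fun e : ℝ => (p.1 + e, p.2)) := by fun_prop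
    simpa using this.tendsto 0
  have h' := hc.eventually h
  obtain ⟨e, h1, e0⟩ := ((h'.filter_mono nhdsWithin_le_nhds).and
    (self_mem_nhdsWithin : Ioi (0 : ℝ) ∈ 𝓝[>] 0)).exists
  obtain ⟨f, h2, f0⟩ := ((h'.filter_mono nhdsWithin_le_nhds).and
    (self_mem_nhdsWithin : Iio (0 : ℝ) ∈ 𝓝[<] 0)).exists
  have e0' : 0 < e := e0
  have f0' : f < 0 := f0
  simp only at h1 h2
  have i1 : (P - a) * e ≤ 0 := by linarith
  have i2 : (P - a) * f ≤ 0 := by linarith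
  nlinarith [nonpos_of_mul_nonpos_left i1 e0', nonneg_of_mul_nonpos_left i2 f0']

/-- Near `p` the maximum is affine, and every phase attaining it at `p` is an affine minorant
touching it there, hence has the same slope. Distinct bases have distinct x-slopes, so the maximiser
is unique. -/
theorem exists_mem_phaseRegion (hκ : StrictMono κ) (hgen : GenericParameters k κ)
    (hne : (matroid A).Nonempty) {p : ℝ × ℝ} (hp : p ∈ (contourPlot κ A t)ᶜ) :
    ∃ J ∈ matroid A, p ∈ phaseRegion κ A t J := by
  rw [contourPlot, mem_compl_iff, mem_ofPred_eq, not_not] at hp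
  obtain ⟨a, b, d, hp⟩ := hp
  obtain ⟨J, hJ, hmax⟩ := (matroid A).exists_max_image (fun J => phase κ A J p.1 p.2 t)
    (Set.toFinite _) hne
  have hval := maxPhase_eq hJ hmax
  have key : ∀ I ∈ matroid A, phase κ A I p.1 p.2 t = phase κ A J p.1 p.2 t →
      ∑ j ∈ I.1, κ j = a := by
    intro I hI he
    refine coeff_eq_of_eventually_le (Q := ∑ j ∈ I.1, κ j ^ 2) (c := phaseConst κ A t I)
      (b := b) (d := d) (p := p) ?_ ?_
    · filter_upwards [hp] with q hq
      rw [← hq]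
      refine le_trans (le_of_eq ?_) (phase_le_maxPhase hI q)
      rw [phase_eq, linPart_eq]
      ring
    · rw [← hp.self_of_nhds, hval, ← he, phase_eq, linPart_eq]
      ring
  refine ⟨J, hJ, fun I hI hIJ => lt_of_le_of_ne (hmax I hI) fun he => hIJ ?_⟩
  exact sum_parameters_injective hκ hgen ((key I hI he).trans (key J hJ rfl).symm)

/-- The phase regions of the bases are convex, open and pairwise disjoint, and they cover the
complement of the contour plot. -/
theorem connectedComponentIn_eq_phaseRegion (hκ : StrictMono κ) (hgen : GenericParameters k κ)
    {J : KSubset k n} (hJ : J ∈ matroid A) {p : ℝ × ℝ} (hp : p ∈ phaseRegion κ A t J) :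
    connectedComponentIn (contourPlot κ A t)ᶜ p = phaseRegion κ A t J := by
  refine Subset.antisymm ?_ ((convex_phaseRegion J).isPreconnected.subset_connectedComponentIn hp
    (phaseRegion_subset_compl hJ))
  refine isPreconnected_connectedComponentIn.subset_left_of_subset_union
    (v := ⋃ I ∈ {I | I ∈ matroid A ∧ I ≠ J}, phaseRegion κ A t I) (isOpen_phaseRegion J)
    (isOpen_biUnion fun I _ => isOpen_phaseRegion I) ?_ ?_ ?_
  · rw [Set.disjoint_iUnion₂_right]
    intro I hI
    rw [Set.disjoint_left]
    exact fun q h1 h2 => hI.2 (phaseRegion_eq_of_mem hI.1 hJ h2 h1)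
  · intro q hq
    obtain ⟨I, hI, hqI⟩ := exists_mem_phaseRegion hκ hgen ⟨J, hJ⟩
      (connectedComponentIn_subset _ _ hq)
    by_cases hIJ : I = J
    · exact Or.inl (hIJ ▸ hqI)
    · exact Or.inr (mem_biUnion (show I ∈ {I | I ∈ matroid A ∧ I ≠ J} from ⟨hI, hIJ⟩) hqI)
  · exact ⟨p, mem_connectedComponentIn (phaseRegion_subset_compl hJ hp), hp⟩

/-! ### Rays and unbounded regions -/

theorem eventually_phase_lt {I J : KSubset k n} {v : ℝ × ℝ}
    (h : linPart κ I v < linPart κ J v) :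
    ∀ᶠ s : ℝ in atTop,
      phase κ A I (s • v).1 (s • v).2 t < phase κ A J (s • v).1 (s • v).2 t := by
  have h1 : Tendsto (fun s : ℝ => s * (linPart κ J v - linPart κ I v)) atTop atTop :=
    tendsto_id.atTop_mul_const (sub_pos.2 h)
  filter_upwards [h1.eventually_gt_atTop (phaseConst κ A t I - phaseConst κ A t J)] with s hs
  rw [phase_eq, phase_eq, linPart_smul, linPart_smul]
  linarith

theorem eventually_mem_phaseRegion {J : KSubset k n} {v : ℝ × ℝ}
    (h : ∀ I ∈ matroid A, I ≠ J → linPart κ I v < linPart κ J v) :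
    ∀ᶠ s : ℝ in atTop, s • v ∈ phaseRegion κ A t J := by
  refine eventually_all.2 fun I => ?_
  by_cases hI : I ∈ matroid A ∧ I ≠ J
  · filter_upwards [eventually_phase_lt (h I hI.1 hI.2)] with s hs _ _ using hs
  · exact Eventually.of_forall fun s h1 h2 => absurd ⟨h1, h2⟩ hI

theorem linPart_le_of_eventually_mem {J : KSubset k n} {v : ℝ × ℝ}
    (h : ∀ᶠ s : ℝ in atTop, s • v ∈ phaseRegion κ A t J) {I : KSubset k n}
    (hI : I ∈ matroid A) : linPart κ I v ≤ linPart κ J v := by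
  by_contra! hlt
  obtain ⟨s, h1, h2⟩ := (h.and (eventually_phase_lt (A := A) (t := t) hlt)).exists
  exact lt_asymm (h1 I hI (fun he => hlt.ne (by rw [he]))) h2

theorem not_isBounded_of_ray {U : Set (ℝ × ℝ)} {v : ℝ × ℝ} (hv : v ≠ 0)
    (h : ∀ᶠ s : ℝ in atTop, s • v ∈ U) : ¬ Bornology.IsBounded U := by
  intro hU
  obtain ⟨R, hR⟩ := hU.exists_norm_le
  have h1 : Tendsto (fun s : ℝ => s * ‖v‖) atTop atTop :=
    tendsto_id.atTop_mul_const (norm_pos_iff.2 hv)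
  obtain ⟨s, hs, hsR, hs0⟩ :=
    (h.and ((h1.eventually_gt_atTop R).and (eventually_ge_atTop 0))).exists
  have := hR _ hs
  rw [norm_smul, Real.norm_of_nonneg hs0] at this
  linarith

/-- By compactness of the unit sphere, the best gap over J has a positive minimum `F u`. At a point
of norm above `C / F u` this gap outweighs the constants, whose differences are bounded by `C`. -/
theorem isBounded_phaseRegion {J : KSubset k n} {ι : Type*} [Fintype ι] [Nonempty ι]
    (S : ι → KSubset k n) (hS : ∀ r, S r ∈ matroid A) (hne : ∀ r, S r ≠ J)
    (h : ∀ v : ℝ × ℝ, v ≠ 0 → ∃ r, linPart κ J v < linPart κ (S r) v) :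
    Bornology.IsBounded (phaseRegion κ A t J) := by
  set F : ℝ × ℝ → ℝ := fun v => Finset.univ.sup' Finset.univ_nonempty
    (fun r => linPart κ (S r) v - linPart κ J v) with hF
  have hFc : Continuous F := Continuous.finset_sup'_apply _ fun r _ =>
    (continuous_linPart _).sub (continuous_linPart _)
  obtain ⟨u, hu, hmin⟩ := (isCompact_sphere (0 : ℝ × ℝ) 1).exists_isMinOn
    ⟨(1, 0), by simp [Prod.norm_def]⟩ hFc.continuousOn
  have hu0 : u ≠ 0 := fun h0 => by simp [h0] at hu
  have hpos : 0 < F u := by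
    obtain ⟨r, hr⟩ := h u hu0
    exact (sub_pos.2 hr).trans_le
      (Finset.le_sup' (fun r => linPart κ (S r) u - linPart κ J u) (Finset.mem_univ r))
  set C : ℝ := ∑ r, |phaseConst κ A t J - phaseConst κ A t (S r)| with hC
  rw [isBounded_iff_forall_norm_le]
  refine ⟨C / F u, fun p hp => ?_⟩
  rw [le_div_iff₀ hpos]
  rcases eq_or_ne p 0 with rfl | hp0
  · rw [norm_zero, zero_mul]
    exact Finset.sum_nonneg fun r _ => abs_nonneg _
  · have hn := norm_pos_iff.2 hp0
    have hv : ‖p‖⁻¹ • p ∈ Metric.sphere (0 : ℝ × ℝ) 1 := by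
      rw [mem_sphere_zero_iff_norm, norm_smul, norm_inv, norm_norm, inv_mul_cancel₀ hn.ne']
    obtain ⟨r, _, hr⟩ := Finset.exists_mem_eq_sup' Finset.univ_nonempty
      (fun r => linPart κ (S r) (‖p‖⁻¹ • p) - linPart κ J (‖p‖⁻¹ • p))
    have h1 : F u ≤ linPart κ (S r) (‖p‖⁻¹ • p) - linPart κ J (‖p‖⁻¹ • p) :=
      hr ▸ isMinOn_iff.1 hmin _ hv
    rw [linPart_smul, linPart_smul, ← mul_sub, inv_mul_eq_div, le_div_iff₀ hn] at h1
    have h2 := hp (S r) (hS r) (hne r)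
    rw [phase_eq, phase_eq] at h2
    have h3 : |phaseConst κ A t J - phaseConst κ A t (S r)| ≤ C :=
      Finset.single_le_sum (f := fun r => |phaseConst κ A t J - phaseConst κ A t (S r)|)
        (fun r _ => abs_nonneg _) (Finset.mem_univ r)
    have h4 := le_abs_self (phaseConst κ A t J - phaseConst κ A t (S r))
    linarith

/-! ### Dominant exponentials -/

theorem vdm_pos (hκ : StrictMono κ) (J : KSubset k n) : 0 < vdm κ J :=
  Finset.prod_pos fun _ _ => Finset.prod_pos fun _ hj =>
    sub_pos.2 (hκ (Finset.mem_filter.1 hj).2)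

theorem minor_mul_expoSet (hκ : StrictMono κ) {J : KSubset k n} (hJ : 0 < minor A J)
    (x y : ℝ) : minor A J * expoSet κ J x y t = Real.exp (phase κ A J x y t) := by
  rw [phase, Real.exp_add, Real.exp_log (mul_pos hJ (vdm_pos hκ J)), Real.exp_sum, expoSet,
    mul_assoc]
  rfl

theorem isDominantOn_phaseRegion (hκ : StrictMono κ) (hpos : ∀ I ∈ matroid A, 0 < minor A I)
    {J : KSubset k n} (hJ : J ∈ matroid A) : IsDominantOn κ A t (phaseRegion κ A t J) J := by
  refine ⟨hJ, fun p hp I hI => ?_⟩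
  rw [minor_mul_expoSet hκ (hpos I hI), minor_mul_expoSet hκ (hpos J hJ), Real.exp_le_exp]
  rcases eq_or_ne I J with rfl | hne
  · exact le_rfl
  · exact (hp I hI hne).le

theorem eq_of_isDominantOn (hκ : StrictMono κ) (hpos : ∀ I ∈ matroid A, 0 < minor A I)
    {J K : KSubset k n} (hJ : J ∈ matroid A) {p : ℝ × ℝ} (hp : p ∈ phaseRegion κ A t J)
    (hK : IsDominantOn κ A t (phaseRegion κ A t J) K) : K = J := by
  by_contra hne
  have h1 := hK.2 p hp J hJ
  rw [minor_mul_expoSet hκ (hpos J hJ), minor_mul_expoSet hκ (hpos K hK.1),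
    Real.exp_le_exp] at h1
  exact absurd (hp K hK.1 hne) (not_lt.2 h1)

end

end KPSoliton

/-! ### Existence and uniqueness of the labelling. -/

theorem mainTheorem8 {k n : ℕ} [NeZero n] (κ : Fin n → ℝ) (hκ : StrictMono κ)
    (hgen : GenericParameters k κ) (π : Equiv.Perm (Fin n)) (hπ : IsTPSchubertPerm π)
    (A : Matrix (Fin k) (Fin n) ℝ) (hA : A ∈ permCell k π) (t₀ : ℝ) :
    (∃ R : Fin n → KSubset k n, IsUnboundedLabelling κ A t₀ R) ∧
      ∀ R : Fin n → KSubset k n, IsUnboundedLabelling κ A t₀ R →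
        IsIrreducibleNecklace R ∧ IsNecklacePerm R π := by
  obtain ⟨M, I, ⟨_, hMpos, hMzero⟩, hI, hirr, hperm⟩ := hA
  have hM : M = matroid A := by
    ext J
    exact ⟨fun h => (hMpos J h).ne', fun h => by_contra fun hJ => h (hMzero J hJ)⟩
  subst hM
  obtain ⟨m, hσ⟩ := exists_isOneDescentDerangement π hπ
  have hN := isNecklaceAlong_inv hirr hperm
  obtain ⟨φ, hφ⟩ := exists_isCriticalAngles hκ hσ
  obtain ⟨θ, hθ, hθ0, hθφ, hmax⟩ := exists_optimal_angles hκ hgen hI hN hσ hφ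
  have hinj := necklace_injective hI hN hφ hθ hθ0 hθφ hmax
  have hray : ∀ r, ∀ᶠ s : ℝ in atTop, s • direction (θ r) ∈ phaseRegion κ A t₀ (I r) :=
    fun r => eventually_mem_phaseRegion (hmax r)
  have hpt : ∀ r, (phaseRegion κ A t₀ (I r)).Nonempty := fun r =>
    let ⟨s, hs⟩ := (hray r).exists
    ⟨_, hs⟩
  have hregions : Set.range (fun r => phaseRegion κ A t₀ (I r)) =
      unboundedRegions (contourPlot κ A t₀) := by
    ext U
    constructor
    · rintro ⟨r, rfl⟩
      obtain ⟨p, hp⟩ := hpt r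
      exact ⟨⟨p, phaseRegion_subset_compl (hI r).1 hp,
        (connectedComponentIn_eq_phaseRegion hκ hgen (hI r).1 hp).symm⟩,
        not_isBounded_of_ray (direction_ne_zero _) (hray r)⟩
    · rintro ⟨⟨p, hp, rfl⟩, hU⟩
      obtain ⟨J, hJ, hpJ⟩ := exists_mem_phaseRegion hκ hgen ⟨_, (hI 0).1⟩ hp
      rw [connectedComponentIn_eq_phaseRegion hκ hgen hJ hpJ] at hU ⊢
      by_contra hc
      have hne : ∀ r, J ≠ I r := fun r he => hc ⟨r, by rw [he]⟩
      exact hU (isBounded_phaseRegion I (fun r => (hI r).1) (fun r => (hne r).symm)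
        fun v hv => exists_linPart_lt hκ hgen hI hN hσ hv hJ hne)
  refine ⟨⟨I, fun r => phaseRegion κ A t₀ (I r), ⟨?_, hregions, θ, hθ, hθ0, ?_, hray⟩, ?_⟩, ?_⟩
  · intro r s (he : phaseRegion κ A t₀ (I r) = phaseRegion κ A t₀ (I s))
    obtain ⟨p, hp⟩ := hpt r
    exact hinj (phaseRegion_eq_of_mem (hI r).1 (hI s).1 hp (he ▸ hp))
  · exact fun r => (hθφ r).trans (hφ.lt_three_pi r)
  · exact fun r => isDominantOn_phaseRegion hκ hMpos (hI r).1
  · rintro R ⟨U, ⟨hUinj, hUrange, ψ, hψ, hψ0, hψ3, hUray⟩, hdom⟩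
    have hτ : ∀ r, ∃ s, phaseRegion κ A t₀ (I s) = U r := fun r => by
      have : U r ∈ Set.range U := ⟨r, rfl⟩
      rwa [hUrange, ← hregions] at this
    choose τ hτ using hτ
    have hτinj : Function.Injective τ := fun r s he => hUinj (by rw [← hτ r, ← hτ s, he])
    have hUray' : ∀ r, ∀ᶠ s : ℝ in atTop,
        s • direction (ψ r) ∈ phaseRegion κ A t₀ (I (τ r)) := fun r => by
      rw [hτ r]
      exact hUray r
    -- Both listings start with the region containing the far negative x-axis.
    have hτ0 : τ 0 = 0 := by
      have h0 := hray 0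
      rw [hθ0, ← hψ0] at h0
      obtain ⟨s, h1, h2⟩ := ((hUray' 0).and h0).exists
      exact hinj (phaseRegion_eq_of_mem (hI _).1 (hI _).1 h1 h2)
    have hτid := eq_id_of_optimal hI hN hφ hψ hψ0 hψ3 τ hτinj hτ0 fun r J hJ =>
      linPart_le_of_eventually_mem (hUray' r) hJ
    have hR : R = I := by
      funext r
      have hd := hdom r
      rw [← hτ r, hτid, id] at hd
      obtain ⟨p, hp⟩ := hpt r
      exact eq_of_isDominantOn hκ hMpos (hI r).1 hp hd
    rw [hR]
    exact ⟨hirr, hperm⟩
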